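/- **Setting.** Let $d\ge 2$, $\alpha>d$ and $J>0$, let $|\cdot|$ be the $\ell^1$-norm on $\mathbb Z^d$, and put $J_{x,y}=J|x-y|^{-\alpha}$ for $x\ne y$, $J_{x,x}=0$. Connectedness refers to the nearest-neighbour graph. For a finite $\Lambda\subset\mathbb Z^d$ let $\Omega_\Lambda^+$ be the set of all $\sigma\in\{-1,1\}^{\mathbb Z^d}$ with $\sigma_x=+1$ for $x\notin\Lambda$, and $$\mathcal H^{+}_\Lambda(\sigma)=-\sum_{x,y\in\Lambda}J_{x,y}\sigma_x\sigma_y-\sum_{x\in\Lambda,\,y\in\Lambda^c}J_{x,y}\sigma_x .$$ For $A\subset\mathbb Z^d$ put $F_A=\sum_{x\in A,\,y\in A^c}J_{x,y}$, let $I(A)$ be the union of the bounded connected components of $A^c$, and $V(A)=A\cup I(A)$. **Contours.** Let $\partial\sigma$ be the set of all $x$ such that $\sigma$ is not constant on $\{y:|x-y|\le1\}$. For $M,a,r>0$, an $(M,a,r)$-partition of $\partial\sigma$ is a finite partition $\Gamma(\sigma)$ of $\partial\sigma$ into non-empty sets such that for any two distinct $\gamma,\gamma'\in\Gamma(\sigma)$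 the set $\gamma'$ lies in a single connected component of $\gamma^c$, and such that every $\gamma\in\Gamma(\sigma)$ can be written as a union $\gamma=\bigcup_{k=1}^{n}\gamma_k$ with $1\le n\le 2^r-1$ in such a way that, for all distinct $\gamma,\gamma'\in\Gamma(\sigma)$, $$\mathrm d(\gamma,\gamma')>M\,\max\Big\{1,\min\big\{\max_k\operatorname{diam}\gamma_k,\ \max_j\operatorname{diam}\gamma'_j\big\}\Big\}^{a}.$$ The elements $\gamma$ of $\Gamma(\sigma)$ are (the supports $\mathrm{sp}(\gamma)=\gamma$ of) the contours of $\sigma$, and $|\gamma|$ is the number of sites of $\gamma$. The label of $\gamma$ is $+1$ if $\sigma=+1$ on the set of all points outside $V(\gamma)$ that have a neighbour in $V(\gamma)$. A connected component $C$ of $I(\gamma)$ has label $\pm1$ if $\sigma=\pm1$ at all points of $V(C)$ that have a neighbour outside $V(C)$; $I_\pm(\gamma)$ is the union of the components of $I(\gamma)$ with label $\pm1$. **Flip.** For a family $\Gamma\subset\Gamma(\sigma)$ let $\tau_\Gamma(\sigma)_x=+1$ if $x\in\bigcup_{\gamma\in\Gamma}\mathrm{sp}(\gamma)$, $\tau_\Gamma(\sigma)_x=-\sigma_x$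 if $x\in\bigcup_{\gamma\in\Gamma}I_-(\gamma)$, and $\tau_\Gamma(\sigma)_x=\sigma_x$ otherwise. **Proposition.** Let $a>\frac{d+1}{\min\{\alpha-d,1\}}$ and $r>0$. There are constants $M_0,c_1',c_2',c_3'>0$, depending only on $d,\alpha,J,a,r$, such that the following holds for all $M\ge M_0$, all finite $\Lambda\subset\mathbb Z^d$, all $\sigma\in\Omega_\Lambda^+$ and every $(M,a,r)$-partition $\Gamma(\sigma)$ of $\partial\sigma$. If $\Gamma\subset\Gamma(\sigma)$ is a family of contours with label $+1$ and $V(\gamma)\subset\Lambda$ for all $\gamma\in\Gamma$, which are external to each other ($\gamma\not\subset V(\gamma')$ for distinct $\gamma,\gamma'\in\Gamma$), then $$\mathcal H^{+}_\Lambda(\tau_\Gamma(\sigma))-\mathcal H^{+}_\Lambda(\sigma)\le\sum_{\gamma\in\Gamma}\Big(-c_1'|\gamma|-c_2'F_{I_-(\gamma)}-c_3'F_{\mathrm{sp}(\gamma)}\Big).$$ In particular, for $\Gamma=\{\gamma\}$ the right-hand side is $-c_1'|\gamma|-c_2'F_{I_-(\gamma)}-c_3'F_{\mathrm{sp}(\gamma)}$.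 -/

import Mathlib

namespace LongRangeIsing

/-- The sites of the lattice `ℤ^d`. -/
abbrev Site (d : ℕ) : Type := Fin d → ℤ

/-- Spin configurations; `ℤˣ = {1, -1}`. -/
abbrev Config (d : ℕ) : Type := Site d → ℤˣ

/-- The `ℓ¹` distance on `ℤ^d`. -/
def l1dist {d : ℕ} (x y : Site d) : ℕ := ∑ i, (x i - y i).natAbs

/-- The nearest-neighbour graph on `ℤ^d`. -/
def lattice (d : ℕ) : SimpleGraph (Site d) where
  Adj x y := l1dist x y = 1
  symm := ⟨fun x y h => by
    have e : l1dist y x = l1dist x y :=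
      Finset.sum_congr rfl fun i _ => by rw [← Int.natAbs_neg, neg_sub]
    rw [e]; exact h⟩
  loopless := ⟨fun x h => by simp [l1dist] at h⟩

/-! ### Energy -/

noncomputable section

/-- The couplings `J |x - y|^{-α}` for `x ≠ y`, and `0` for `x = y`. -/
def coupling {d : ℕ} (J α : ℝ) (x y : Site d) : ℝ :=
  if x = y then 0 else J * (l1dist x y : ℝ) ^ (-α)

/-- A spin as a real number. -/
def spin {d : ℕ} (σ : Config d) (x : Site d) : ℝ := ((σ x : ℤ) : ℝ)

/-- The Hamiltonian in the finite volume `Λ` with boundary condition `η`; the first sum runs over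
all `(x, y) ∈ Λ × Λ`. -/
def hamiltonian {d : ℕ} (J α : ℝ) (Λ : Finset (Site d)) (η σ : Config d) : ℝ :=
  - (∑ x ∈ Λ, ∑ y ∈ Λ, coupling J α x y * spin σ x * spin σ y)
    - ∑ x ∈ Λ, ∑' y : {y : Site d // y ∉ Λ}, coupling J α x y * spin σ x * spin η y

/-- The `+` boundary condition. -/
def plus (d : ℕ) : Config d := fun _ => 1

/-- The configurations that agree with `η` outside `Λ`. -/
def configsWithBC {d : ℕ} (Λ : Finset (Site d)) (η : Config d) : Set (Config d) :=
  {σ | ∀ x, x ∉ Λ → σ x = η x}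

/-- `F_A`, the sum of the couplings between `A` and its complement. -/
def surfaceEnergy {d : ℕ} (J α : ℝ) (A : Set (Site d)) : ℝ :=
  ∑' x : A, ∑' y : (Aᶜ : Set (Site d)), coupling J α (x : Site d) (y : Site d)

end

/-! ### Geometry of subsets of the lattice -/

/-- The connected component of `x` in the subgraph induced by `A` (empty if `x ∉ A`). -/
def component {d : ℕ} (A : Set (Site d)) (x : Site d) : Set (Site d) :=
  {y | ∃ (hx : x ∈ A) (hy : y ∈ A), ((lattice d).induce A).Reachable ⟨x, hx⟩ ⟨y, hy⟩}

/-- `I(A)`, the union of the bounded connected components of `Aᶜ`. -/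
def inside {d : ℕ} (A : Set (Site d)) : Set (Site d) :=
  {x | x ∉ A ∧ (component Aᶜ x).Finite}

/-- `V(A) = A ∪ I(A)`. -/
def volume {d : ℕ} (A : Set (Site d)) : Set (Site d) := A ∪ inside A

/-- The points of `A` with a neighbour outside `A`. -/
def innerBoundary {d : ℕ} (A : Set (Site d)) : Set (Site d) :=
  {x | x ∈ A ∧ ∃ y, y ∉ A ∧ (lattice d).Adj x y}

/-- The points outside `A` with a neighbour in `A`. -/
def outerBoundary {d : ℕ} (A : Set (Site d)) : Set (Site d) :=
  {x | x ∉ A ∧ ∃ y, y ∈ A ∧ (lattice d).Adj x y}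

/-- The `ℓ¹` diameter of a finite set. -/
def diam {d : ℕ} (A : Finset (Site d)) : ℕ := (A ×ˢ A).sup fun p => l1dist p.1 p.2

/-- The largest diameter of a member of a finite family of sets. -/
def maxDiam {d : ℕ} (F : Finset (Finset (Site d))) : ℕ := F.sup diam

/-! ### Contours -/

/-- `∂σ`, the set of incorrect points: those `x` for which `σ` is not constant on the closed
`ℓ¹` unit ball around `x`. -/
def boundary {d : ℕ} (σ : Config d) : Set (Site d) :=
  {x | ∃ y, (lattice d).Adj x y ∧ σ y ≠ σ x}

/-- `P` is an `(M, a, r)`-partition of `∂σ`; its members are the supports of the contours of `σ`.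
In `separated`, each `γ ∈ P` is cut into at least one and at most `2^r - 1` pieces. The cut-off by
`1` is there since a piece that is a single site has diameter `0`. -/
structure IsContourPartition {d : ℕ} (M a r : ℝ) (σ : Config d)
    (P : Finset (Finset (Site d))) : Prop where
  nonempty : ∀ γ ∈ P, γ.Nonempty
  disjoint : ∀ γ ∈ P, ∀ γ' ∈ P, γ ≠ γ' → Disjoint γ γ'
  cover : ∀ x, x ∈ boundary σ ↔ ∃ γ ∈ P, x ∈ γ
  one_component : ∀ γ ∈ P, ∀ γ' ∈ P, γ ≠ γ' →
    ∃ x, (γ' : Set (Site d)) ⊆ component ((γ : Set (Site d))ᶜ) x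
  separated : ∃ pieces : Finset (Site d) → Finset (Finset (Site d)),
    (∀ γ ∈ P, 1 ≤ (pieces γ).card ∧ ((pieces γ).card : ℝ) ≤ (2 : ℝ) ^ r - 1 ∧
      (pieces γ).sup id = γ) ∧
    ∀ γ ∈ P, ∀ γ' ∈ P, γ ≠ γ' → ∀ x ∈ γ, ∀ y ∈ γ',
      M * ((max 1 (min (maxDiam (pieces γ)) (maxDiam (pieces γ'))) : ℕ) : ℝ) ^ a < (l1dist x y : ℝ)

/-- The contour with support `γ` has (outer) label `s`: the spins on the outer boundary of `V(γ)`
are `s`. -/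
def HasLabel {d : ℕ} (σ : Config d) (γ : Finset (Site d)) (s : ℤˣ) : Prop :=
  ∀ x ∈ outerBoundary (volume (γ : Set (Site d))), σ x = s

/-- `I_s(γ)`: the union of those connected components `C` of `I(γ)` that have label `s`, that is,
the spins on the inner boundary of `V(C)` are `s`. -/
def labelledInside {d : ℕ} (σ : Config d) (γ : Finset (Site d)) (s : ℤˣ) : Set (Site d) :=
  {x | x ∈ inside (γ : Set (Site d)) ∧
    ∀ y ∈ innerBoundary (volume (component ((γ : Set (Site d))ᶜ) x)), σ y = s}

/-- `Γ` is a family of contours of `σ`, out of the partition `P`, that are external to each other,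
have label `s`, and whose volumes lie in `Λ`. -/
structure IsExternalFamily {d : ℕ} (Λ : Finset (Site d)) (σ : Config d)
    (P Γ : Finset (Finset (Site d))) (s : ℤˣ) : Prop where
  subset : Γ ⊆ P
  external : ∀ γ ∈ Γ, ∀ γ' ∈ Γ, γ ≠ γ' → ¬ ((γ : Set (Site d)) ⊆ volume (γ' : Set (Site d)))
  label : ∀ γ ∈ Γ, HasLabel σ γ s
  volume_subset : ∀ γ ∈ Γ, volume (γ : Set (Site d)) ⊆ (Λ : Set (Site d))

open Classical in
/-- The flip `τ_Γ` for contours of label `+1`: the spins on the supports become `+1`, those in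
`I_-(Γ)` are reversed, and those in `I_+(Γ)` and outside `V(Γ)` are kept. -/
noncomputable def contourFlip {d : ℕ} (Γ : Finset (Finset (Site d))) (σ : Config d) : Config d :=
  fun x =>
    if ∃ γ ∈ Γ, x ∈ γ then 1
    else if ∃ γ ∈ Γ, x ∈ labelledInside σ γ (-1) then - σ x
    else σ x

end LongRangeIsing

/-! Each contour `γ` gets its own spin configuration `s γ`, equal to `1` at infinity, whose sign
changes are those of `σ` at `γ`. It exists because contours are more than two apart, so the sign
changes at `γ` alone still multiply to `1` around every plaquette (`exists_contourSpin`). Then `σ`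
is the product of all `s γ` (`eq_prod_contourSpin`), `I_-(γ)` is the negative region of `s γ` off
`γ`, and the flip multiplies `σ` by the `s γ` with `γ ∈ Γ` (`contourFlip_eq_mul`).

Let `F γ` be the energy of the pairs with `s γ` negative at the first end and positive at the
second, and `E γ` the part of it from pairs on which another contour spin changes too. A pair gains
energy when the flip restores agreement and loses it only when some remaining spin changes as well;
counting gives a change of at most `-2 ∑ F γ + 10 ∑ E γ`. So it suffices that `E γ ≤ F γ / 10`.

This is `pairEnergy_interaction_le`, with contours compared by their scale `D`. If the other contour
is at least as large, the at most `K * D γ ^ d` negative sites of `γ` are at distance of order `M *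
D γ ^ a` from its sign changes; since `d / a < α - d`, the total is at most a constant times `M ^
(-d / a)`, whereas `F γ ≥ J`. If it is smaller, the site energy of `s γ` at its negative sites is
averaged over segments of length of order `M * D γ' ^ a`. Only one contour of each scale can reach a
given site, so the loss is a fraction of order `M⁻¹ ∑ m ^ (d - a)` of `F γ`, finite since `a > d +
1`. Finally `F γ` dominates `|γ|`, and through it both surface energies. -/

namespace LongRangeIsing

variable {d : ℕ}

open scoped ENNReal

/-! ### The `ℓ¹` distance and paths in the lattice -/

theorem l1dist_self (x : Site d) : l1dist x x = 0 := by simp [l1dist]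

theorem l1dist_comm (x y : Site d) : l1dist x y = l1dist y x :=
  Finset.sum_congr rfl fun i _ => by rw [← Int.natAbs_neg, neg_sub]

theorem l1dist_triangle (x y z : Site d) : l1dist x z ≤ l1dist x y + l1dist y z := by
  unfold l1dist
  rw [← Finset.sum_add_distrib]
  exact Finset.sum_le_sum fun i _ => by omega

theorem l1dist_eq_zero {x y : Site d} : l1dist x y = 0 ↔ x = y := by
  constructor
  · intro h
    funext i
    have := (Finset.sum_eq_zero_iff.1 h) i (Finset.mem_univ i)
    omega
  · rintro rfl
    exact l1dist_self x

theorem natAbs_sub_le_l1dist (x y : Site d) (i : Fin d) : (x i - y i).natAbs ≤ l1dist x y :=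
  Finset.single_le_sum (f := fun i => (x i - y i).natAbs) (fun _ _ => Nat.zero_le _)
    (Finset.mem_univ i)

theorem l1dist_update (x : Site d) (i : Fin d) (u v : ℤ) :
    l1dist (Function.update x i u) (Function.update x i v) = (u - v).natAbs := by
  unfold l1dist
  rw [Finset.sum_eq_single i]
  · simp
  · intro j _ hj
    simp [Function.update_of_ne hj]
  · simp

theorem l1dist_add_single (x : Site d) (i : Fin d) (t : ℤ) :
    l1dist x (x + Pi.single i t) = t.natAbs := by
  have h := l1dist_update x i (x i) (x i + t)
  rw [Function.update_eq_self] at h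
  rw [show x + Pi.single i t = Function.update x i (x i + t) from ?_, h]
  · omega
  · funext j
    by_cases hj : j = i
    · subst hj; simp
    · simp [hj]

theorem adj_add_single (x : Site d) (i : Fin d) : (lattice d).Adj x (x + Pi.single i 1) :=
  l1dist_add_single x i 1

theorem adj_iff_exists_single {x y : Site d} :
    (lattice d).Adj x y ↔ ∃ i, y = x + Pi.single i 1 ∨ x = y + Pi.single i 1 := by
  constructor
  · intro h
    have h1 : ∑ i, (x i - y i).natAbs = 1 := h
    obtain ⟨i, hi, hpos⟩ : ∃ i ∈ Finset.univ, (x i - y i).natAbs ≠ 0 :=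
      Finset.exists_ne_zero_of_sum_ne_zero (by omega)
    have hsplit := Finset.add_sum_erase Finset.univ (fun i => (x i - y i).natAbs) hi
    have hrest : ∑ j ∈ Finset.univ.erase i, (x j - y j).natAbs = 0 := by omega
    have hj : ∀ j, j ≠ i → x j = y j := fun j hj => by
      have := (Finset.sum_eq_zero_iff.1 hrest) j (Finset.mem_erase.2 ⟨hj, Finset.mem_univ j⟩)
      omega
    refine ⟨i, ?_⟩
    have hone : (x i - y i).natAbs = 1 := by omega
    rcases Int.natAbs_eq_iff.1 hone with h | h
    · right
      funext j
      by_cases hji : j = i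
      · subst hji
        simp only [Pi.add_apply, Pi.single_eq_same]
        push_cast at h; omega
      · simp [hji, hj j hji]
    · left
      funext j
      by_cases hji : j = i
      · subst hji
        simp only [Pi.add_apply, Pi.single_eq_same]
        push_cast at h; omega
      · simp [hji, hj j hji]
  · rintro ⟨i, rfl | rfl⟩
    · exact adj_add_single x i
    · exact (adj_add_single y i).symm

/-- A function that does not change across the edges outside `A` takes the same value at the ends
of a coordinate segment outside `A`. -/
theorem eq_of_segment {X : Type*} {A : Set (Site d)} {s : Site d → X}
    (hs : ∀ x y, (lattice d).Adj x y → x ∉ A → y ∉ A → s x = s y) (x : Site d) (i : Fin d)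
    (u v : ℤ) (h : ∀ t ∈ Set.uIcc u v, Function.update x i t ∉ A) :
    s (Function.update x i u) = s (Function.update x i v) := by
  wlog huv : u ≤ v generalizing u v
  · exact (this v u (by rwa [Set.uIcc_comm]) (by omega)).symm
  rw [Set.uIcc_of_le huv] at h
  induction v, huv using Int.leInduction with
  | base => rfl
  | succ v huv ih =>
    rw [ih fun t ht => h t ⟨ht.1, ht.2.trans (by omega)⟩]
    refine hs _ _ ?_ (h v ⟨huv, by omega⟩) (h (v + 1) ⟨by omega, le_rfl⟩)
    change l1dist _ _ = 1
    rw [l1dist_update]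
    omega

/-- A function that does not change across the edges outside `A` takes the same value at opposite
corners of a box outside `A`. -/
theorem eq_of_box {X : Type*} {A : Set (Site d)} {s : Site d → X}
    (hs : ∀ x y, (lattice d).Adj x y → x ∉ A → y ∉ A → s x = s y) (x y : Site d)
    (h : ∀ z : Site d, (∀ i, z i ∈ Set.uIcc (x i) (y i)) → z ∉ A) : s x = s y := by
  have key : ∀ S : Finset (Fin d), s x = s (fun i => if i ∈ S then y i else x i) := by
    intro S
    induction S using Finset.induction_on with
    | empty => simp
    | insert j S hj ih =>
      rw [ih]
      have e1 : (fun i => if i ∈ S then y i else x i) =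
          Function.update (fun i => if i ∈ S then y i else x i) j (x j) := by
        funext i
        by_cases hij : i = j
        · subst hij; simp [hj]
        · simp [hij]
      have e2 : (fun i => if i ∈ insert j S then y i else x i) =
          Function.update (fun i => if i ∈ S then y i else x i) j (y j) := by
        funext i
        by_cases hij : i = j
        · subst hij; simp
        · simp [hij]
      rw [e2]
      conv_lhs => rw [e1]
      refine eq_of_segment hs _ j _ _ fun t ht => h _ fun i => ?_
      by_cases hij : i = j
      · subst hij; simpa using ht
      · rw [Function.update_of_ne hij]
        split_ifs
        · exact Set.right_mem_uIcc
        · exact Set.left_mem_uIcc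
  simpa using key Finset.univ

/-- The box spanned by `x` and `y` lies in the ball around `x` that reaches `y`. -/
theorem eq_of_l1dist {X : Type*} {A : Set (Site d)} {s : Site d → X}
    (hs : ∀ x y, (lattice d).Adj x y → x ∉ A → y ∉ A → s x = s y) (x y : Site d)
    (h : ∀ z, l1dist x z ≤ l1dist x y → z ∉ A) : s x = s y := by
  refine eq_of_box hs x y fun z hz => h z (Finset.sum_le_sum fun i _ => ?_)
  have := hz i
  rw [Set.mem_uIcc] at this
  omega

/-- The box spanned by two points of a coordinate hyperplane stays in it. A hyperplane missing a
contour is thus a route to infinity, which is how `d ≥ 2` enters later. -/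
theorem eq_of_hyperplane {X : Type*} {A : Set (Site d)} {s : Site d → X}
    (hs : ∀ x y, (lattice d).Adj x y → x ∉ A → y ∉ A → s x = s y) (x y : Site d) (i : Fin d)
    (hxy : x i = y i) (h : ∀ z : Site d, z i = x i → z ∉ A) : s x = s y := by
  refine eq_of_box hs x y fun z hz => h z ?_
  have := hz i
  rw [← hxy, Set.mem_uIcc] at this
  omega

theorem eq_of_adj_eq {X : Type*} {s : Site d → X}
    (hs : ∀ x y, (lattice d).Adj x y → s x = s y) (x y : Site d) : s x = s y :=
  eq_of_box (A := ∅) (fun x y h _ _ => hs x y h) x y fun _ _ h => h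

/-- A non-empty proper subset of the lattice has a boundary edge. -/
theorem exists_boundary_edge {A : Set (Site d)} (hne : A.Nonempty) (hA : A ≠ Set.univ) :
    ∃ x ∈ A, ∃ y ∉ A, (lattice d).Adj x y := by
  by_contra! hcon
  obtain ⟨x, hx⟩ := hne
  obtain ⟨y, hy⟩ := (Set.ne_univ_iff_exists_notMem A).1 hA
  have : (x ∈ A) = (y ∈ A) := by
    refine eq_of_adj_eq (s := fun z => z ∈ A) (fun u v huv => ?_) x y
    by_cases hu : u ∈ A <;> by_cases hv : v ∈ A
    · simp [hu, hv]
    · exact absurd huv (hcon u hu v hv)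
    · exact absurd huv.symm (hcon v hv u hu)
    · simp [hu, hv]
  exact hy (this ▸ hx)

/-! ### Connected components, inside and volume -/

theorem mem_component_self {A : Set (Site d)} {x : Site d} (hx : x ∈ A) : x ∈ component A x :=
  ⟨hx, hx, SimpleGraph.Reachable.refl _⟩

theorem mem_component_of_adj {A : Set (Site d)} {x y z : Site d} (hy : y ∈ component A x)
    (hz : z ∈ A) (hyz : (lattice d).Adj y z) : z ∈ component A x := by
  obtain ⟨hx, hy', hr⟩ := hy
  refine ⟨hx, hz, hr.trans (SimpleGraph.Adj.reachable ?_)⟩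
  exact hyz

theorem component_eq_of_mem {A : Set (Site d)} {x y : Site d} (hy : y ∈ component A x) :
    component A y = component A x := by
  obtain ⟨hx, hy', hr⟩ := hy
  ext z
  exact ⟨fun ⟨_, hz, h⟩ => ⟨hx, hz, hr.trans h⟩, fun ⟨_, hz, h⟩ => ⟨hy', hz, hr.symm.trans h⟩⟩

/-- A function that does not change across the edges inside `A` is constant on the connected
components of `A`. -/
theorem eq_of_mem_component {X : Type*} {A : Set (Site d)} {s : Site d → X}
    (hs : ∀ x y, (lattice d).Adj x y → x ∈ A → y ∈ A → s x = s y) {x y : Site d}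
    (hy : y ∈ component A x) : s x = s y := by
  obtain ⟨hx, hy', ⟨w⟩⟩ := hy
  have key : ∀ u v : A, ((lattice d).induce A).Walk u v → s u = s v := by
    intro u v w
    induction w with
    | nil => rfl
    | cons h _ ih => exact (hs _ _ h (Subtype.coe_prop _) (Subtype.coe_prop _)).trans ih
  exact key _ _ w

/-- A vertex outside `A` next to a point of the inside of `A` is in the inside of `A`. -/
theorem mem_inside_of_adj {A : Set (Site d)} {x y : Site d} (hx : x ∈ inside A) (hy : y ∉ A)
    (hxy : (lattice d).Adj x y) : y ∈ inside A := by
  have hyc : y ∈ component Aᶜ x := mem_component_of_adj (mem_component_self hx.1) hy hxy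
  exact ⟨hy, by rw [component_eq_of_mem hyc]; exact hx.2⟩

theorem mem_of_adj_of_mem_volume {A : Set (Site d)} {x y : Site d} (hx : x ∈ volume A)
    (hy : y ∉ volume A) (hxy : (lattice d).Adj x y) : x ∈ A := by
  rcases hx with hx | hx
  · exact hx
  · exact absurd (Or.inr (mem_inside_of_adj hx (fun h => hy (Or.inl h)) hxy)) hy

theorem exists_bound {A : Set (Site d)} (hA : A.Finite) : ∃ N : ℕ, ∀ x ∈ A, ∀ i, |x i| ≤ N := by
  refine ⟨∑ x ∈ hA.toFinset, l1dist x 0, fun x hx i => ?_⟩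
  have h1 : l1dist x 0 ≤ ∑ x ∈ hA.toFinset, l1dist x 0 :=
    Finset.single_le_sum (f := fun x => l1dist x 0) (fun _ _ => Nat.zero_le _)
      (hA.mem_toFinset.2 hx)
  have h2 := natAbs_sub_le_l1dist x 0 i
  simp only [Pi.zero_apply, sub_zero] at h2
  have : (x i).natAbs ≤ ∑ x ∈ hA.toFinset, l1dist x 0 := h2.trans h1
  zify at this ⊢
  exact this

theorem infinite_of_segments {A : Set (Site d)} (x : Site d) (i : Fin d)
    (h : ∀ t : ℕ, Function.update x i (x i + t) ∈ A) : A.Infinite := by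
  refine Set.infinite_of_injective_forall_mem (f := fun t : ℕ => Function.update x i (x i + t))
    (fun t t' htt => ?_) h
  have := congrFun htt i
  simpa using this

/-- Beyond a cube containing `A`, a coordinate ray avoids `A`, so its component in the complement is
unbounded. -/
theorem volume_ne_univ (hd : 0 < d) {A : Set (Site d)} (hA : A.Finite) :
    volume A ≠ Set.univ := by
  obtain ⟨N, hN⟩ := exists_bound hA
  rw [Set.ne_univ_iff_exists_notMem]
  have hz : ∀ t : ℤ, 0 ≤ t →
      Function.update (fun _ : Fin d => (N : ℤ) + 1) ⟨0, hd⟩ (N + 1 + t) ∉ A := by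
    intro t ht hmem
    have h := hN _ hmem ⟨0, hd⟩
    rw [Function.update_self] at h
    have := le_abs_self ((N : ℤ) + 1 + t)
    omega
  have h0 : (fun _ : Fin d => (N : ℤ) + 1) ∉ A := by
    have := hz 0 le_rfl
    rwa [add_zero, Function.update_eq_self_iff.2 rfl] at this
  refine ⟨fun _ => N + 1, ?_⟩
  rintro (h | h)
  · exact h0 h
  · refine infinite_of_segments (fun _ : Fin d => (N : ℤ) + 1) ⟨0, hd⟩ (fun t => ?_) h.2
    have := eq_of_segment (A := A) (s := fun y => y ∈ component Aᶜ fun _ => (N : ℤ) + 1)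
      (fun x y hxy hx hy => propext ⟨fun h => mem_component_of_adj h hy hxy,
        fun h => mem_component_of_adj h hx hxy.symm⟩)
      (fun _ => (N : ℤ) + 1) ⟨0, hd⟩ (N + 1) (N + 1 + t) (fun u hu => ?_)
    · rw [Function.update_eq_self_iff.2 rfl] at this
      exact this ▸ mem_component_self h0
    · rw [Set.uIcc_of_le (by omega)] at hu
      have := hz (u - (N + 1)) (by have := hu.1; omega)
      rwa [add_sub_cancel] at this

/-! ### Closed cochains on the lattice are exact -/

theorem exists_discrete_primitive (g : ℤ → ℤˣ) : ∃ h : ℤ → ℤˣ, ∀ n, h (n + 1) = h n * g n := by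
  -- One of the two intervals is always empty; as units of `ℤ` are their own inverses, no inverse is
  -- needed for negative `n`.
  refine ⟨fun n => (∏ i ∈ Finset.Ico 0 n, g i) * ∏ i ∈ Finset.Ico n 0, g i, fun n => ?_⟩
  beta_reduce
  rcases le_or_gt 0 n with hn | hn
  · rw [Finset.Ico_eq_empty (a := n) (by omega), Finset.Ico_eq_empty (a := n + 1) (by omega),
      ← Finset.insert_Ico_right_eq_Ico_add_one hn, Finset.prod_insert (by simp)]
    simp [mul_comm]
  · rw [Finset.Ico_eq_empty (b := n) (by omega), Finset.Ico_eq_empty (b := n + 1) (by omega),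
      ← Finset.insert_Ico_add_one_left_eq_Ico (a := n) (b := 0) hn, Finset.prod_insert (by simp)]
    rw [Finset.prod_empty, one_mul, one_mul, mul_right_comm, Int.units_mul_self, one_mul]

/-- A `ℤˣ`-valued closed `1`-cochain on `ℤ^d` has a potential. -/
theorem exists_potential (f : Site d → Fin d → ℤˣ)
    (hf : ∀ x i j, f x i * f (x + Pi.single i 1) j = f x j * f (x + Pi.single j 1) i) :
    ∃ s : Config d, ∀ x i, s (x + Pi.single i 1) = s x * f x i := by
  choose primitive hprim using exists_discrete_primitive
  suffices key : ∀ k ≤ d, ∃ s : Config d, ∀ x (i : Fin d), (i : ℕ) < k →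
      s (x + Pi.single i 1) = s x * f x i by
    obtain ⟨s, hs⟩ := key d le_rfl
    exact ⟨s, fun x i => hs x i i.2⟩
  intro k
  induction k with
  | zero => exact fun _ => ⟨fun _ => 1, fun x i hi => absurd hi (by omega)⟩
  | succ k ih =>
    intro hk
    obtain ⟨s, hs⟩ := ih (by omega)
    set κ : Fin d := ⟨k, by omega⟩ with hκ
    -- The potential is built one direction at a time. `g` is the error of `s` in the new direction
    -- `κ`; closedness makes it invariant under the directions already treated, so integrating it
    -- along `κ` does not spoil them.
    set g : Site d → ℤˣ := fun x => f x κ * (s x * s (x + Pi.single κ 1)) with hg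
    have hginv : ∀ x (i : Fin d), (i : ℕ) < k → g (x + Pi.single i 1) = g x := by
      intro x i hi
      simp only [hg]
      rw [hs x i hi, add_right_comm, hs _ i hi]
      calc f (x + Pi.single i 1) κ * (s x * f x i * (s (x + Pi.single κ 1) *
              f (x + Pi.single κ 1) i))
          = (f x i * f (x + Pi.single i 1) κ) * f (x + Pi.single κ 1) i *
              (s x * s (x + Pi.single κ 1)) := by ac_rfl
        _ = f x κ * (f (x + Pi.single κ 1) i * f (x + Pi.single κ 1) i) *
              (s x * s (x + Pi.single κ 1)) := by rw [hf x i κ]; ac_rfl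
        _ = _ := by rw [Int.units_mul_self, mul_one]
    refine ⟨fun x => s x * primitive (fun n => g (Function.update x κ n)) (x κ), ?_⟩
    intro x i hi
    rcases Nat.lt_succ_iff_lt_or_eq.1 hi with hi | hi
    · have hne : κ ≠ i := fun h => by rw [← h] at hi; simp [hκ] at hi
      have hup : ∀ n, Function.update (x + Pi.single i 1) κ n =
          Function.update x κ n + Pi.single i 1 := by
        intro n
        funext j
        by_cases hj : j = κ
        · subst hj; simp [hne]
        · simp [hj]
      simp only [hup, hginv _ i hi, Pi.add_apply, Pi.single_eq_of_ne hne, add_zero, hs x i hi]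
      ac_rfl
    · obtain rfl : i = κ := Fin.ext hi
      have hup : ∀ n, Function.update (x + Pi.single κ 1) κ n = Function.update x κ n := by
        intro n
        funext j
        by_cases hj : j = κ
        · subst hj; simp
        · simp [hj]
      simp only [hup, Pi.add_apply, Pi.single_eq_same, hprim, Function.update_eq_self, hg]
      set p := primitive _ _
      calc s (x + Pi.single κ 1) * (p * (f x κ * (s x * s (x + Pi.single κ 1))))
          = (s (x + Pi.single κ 1) * s (x + Pi.single κ 1)) * (s x * p * f x κ) := by ac_rfl
        _ = _ := by rw [Int.units_mul_self, one_mul]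

/-! ### The spin configuration of a single contour -/

/-- `s` is the configuration, equal to `1` at infinity, whose spin changes are those of `σ` at the
points of `γ`. -/
structure IsContourSpin (σ : Config d) (γ : Finset (Site d)) (s : Config d) : Prop where
  edge : ∀ x y, (lattice d).Adj x y → s x * s y = if x ∈ γ then σ x * σ y else 1
  finite : {x | s x ≠ 1}.Finite

theorem units_mul_eq_one_iff {u v : ℤˣ} : u * v = 1 ↔ u = v := by
  rw [mul_eq_one_iff_eq_inv, Int.units_inv_eq_self]

/-- On a plaquette near `γ` the restricted cochain coincides with that of `σ`, since every changing
edge there starts in `γ`; on any other plaquette it is trivial. Hence it is closed. As `d ≥ 2`, the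
potential is constant outside a cube and can be normalised there. -/
theorem exists_contourSpin (hd : 2 ≤ d) (σ : Config d) (γ : Finset (Site d))
    (hγ : ∀ x ∈ γ, ∀ y ∈ boundary σ, l1dist x y ≤ 2 → y ∈ γ) :
    ∃ s, IsContourSpin σ γ s := by
  have hmem : ∀ u v, (lattice d).Adj u v → σ u ≠ σ v → ∀ c ∈ γ, l1dist c u ≤ 2 → u ∈ γ :=
    fun u v huv hσ c hc h => hγ c hc u ⟨v, huv, hσ.symm⟩ h
  have hcorner : ∀ u v, (lattice d).Adj u v → ∀ c ∈ γ, l1dist c u ≤ 2 →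
      (if u ∈ γ then σ u * σ v else 1) = σ u * σ v := by
    intro u v huv c hc hcu
    by_cases hσ : σ u = σ v
    · simp [hσ]
    · rw [if_pos (hmem u v huv hσ c hc hcu)]
  obtain ⟨s, hs⟩ := exists_potential
    (fun x i => if x ∈ γ then σ x * σ (x + Pi.single i 1) else 1) (by
      intro x i j
      have axi := adj_add_single x i
      have axj := adj_add_single x j
      have aij := adj_add_single (x + Pi.single i 1) j
      have aji := adj_add_single (x + Pi.single j 1) i
      have dxi : l1dist x (x + Pi.single i 1) = 1 := axi
      have dxj : l1dist x (x + Pi.single j 1) = 1 := axj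
      have dxi' : l1dist (x + Pi.single i 1) x = 1 := axi.symm
      have dxj' : l1dist (x + Pi.single j 1) x = 1 := axj.symm
      have tij := l1dist_triangle (x + Pi.single i 1) x (x + Pi.single j 1)
      have tji := l1dist_triangle (x + Pi.single j 1) x (x + Pi.single i 1)
      have hcomm : x + Pi.single i 1 + Pi.single j 1 = x + Pi.single j 1 + Pi.single i 1 :=
        add_right_comm _ _ _
      -- Only these three vertices are base points of edges of the plaquette, and they are at mutual
      -- distance at most `2`; the fourth vertex need not be tested.
      by_cases h : ∃ c ∈ γ, l1dist c x ≤ 2 ∧ l1dist c (x + Pi.single i 1) ≤ 2 ∧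
          l1dist c (x + Pi.single j 1) ≤ 2
      · obtain ⟨c, hc, h0, hi, hj⟩ := h
        rw [hcorner _ _ axi c hc h0, hcorner _ _ axj c hc h0, hcorner _ _ aij c hc hi,
          hcorner _ _ aji c hc hj, hcomm, mul_assoc, ← mul_assoc (σ (x + Pi.single i 1)),
          Int.units_mul_self, mul_assoc (σ x), ← mul_assoc (σ (x + Pi.single j 1)),
          Int.units_mul_self]
      · push Not at h
        have h0 : x ∉ γ := fun hx => by
          have := h x hx (by rw [l1dist_self]; omega) (by omega); omega
        have h1 : x + Pi.single i 1 ∉ γ := fun hx => by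
          have := h _ hx (by omega) (by rw [l1dist_self]; omega); omega
        have h2 : x + Pi.single j 1 ∉ γ := fun hx => by
          have := h _ hx (by omega) (by omega); rw [l1dist_self] at this; omega
        simp [h0, h1, h2])
  have hedge : ∀ x y, (lattice d).Adj x y → s x * s y = if x ∈ γ then σ x * σ y else 1 := by
    intro x y hxy
    obtain ⟨i, rfl | rfl⟩ := adj_iff_exists_single.1 hxy
    · rw [hs, ← mul_assoc, Int.units_mul_self, one_mul]
    · rw [hs, mul_right_comm, Int.units_mul_self, one_mul]
      by_cases hσ : σ y = σ (y + Pi.single i 1)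
      · simp [hσ]
      · have : y ∈ γ ↔ y + Pi.single i 1 ∈ γ :=
          ⟨fun h => hmem _ _ hxy (Ne.symm hσ) y h (le_of_eq_of_le hxy.symm (by omega)),
            fun h => hmem _ _ hxy.symm hσ _ h (le_of_eq_of_le hxy (by omega))⟩
        simp only [this, mul_comm]
  have hconst : ∀ x y, (lattice d).Adj x y → x ∉ (γ : Set (Site d)) → y ∉ (γ : Set (Site d)) →
      s x = s y := fun x y hxy hx _ => by
    have := hedge x y hxy
    rw [if_neg (by simpa using hx)] at this
    exact units_mul_eq_one_iff.1 this
  obtain ⟨N, hN⟩ := exists_bound γ.finite_toSet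
  have hout : ∀ z : Site d, ∀ i, (N : ℤ) < |z i| → z ∉ (γ : Set (Site d)) := fun z i hi hz => by
    have := hN z hz i
    omega
  have hfar : ∀ z : Site d, ∀ i, (N : ℤ) < |z i| → s z = s fun _ => (N : ℤ) + 1 := by
    intro z i hi
    obtain ⟨j, hj⟩ : ∃ j : Fin d, j ≠ i := by
      have : Nontrivial (Fin d) := Fin.nontrivial_iff_two_le.2 hd
      exact exists_ne i
    have hN1 : (N : ℤ) < |(N : ℤ) + 1| := by
      have := le_abs_self ((N : ℤ) + 1); omega
    -- Two moves outside the cube: first in the hyperplane fixing coordinate `i`, until all other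
    -- coordinates are `N + 1`, then in the hyperplane fixing coordinate `j` at `N + 1`.
    rw [eq_of_hyperplane hconst z (Function.update (fun _ => (N : ℤ) + 1) i (z i)) i (by simp)
      fun w hw => hout w i (by rwa [hw])]
    refine eq_of_hyperplane hconst _ _ j (by simp [hj]) fun w hw => hout w j ?_
    rwa [hw, Function.update_of_ne hj]
  -- Multiplying by the value at infinity makes the spin `1` there and changes no edge.
  refine ⟨fun x => s x * s fun _ => (N : ℤ) + 1, fun x y hxy => ?_, ?_⟩
  · rw [← hedge x y hxy, mul_mul_mul_comm, Int.units_mul_self, mul_one]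
  · refine (Set.finite_Icc (fun _ : Fin d => -(N : ℤ)) fun _ => (N : ℤ)).subset fun x hx => ?_
    by_contra hcon
    apply hx
    obtain ⟨i, hi⟩ : ∃ i, (N : ℤ) < |x i| := by
      by_contra! h
      exact hcon ⟨fun i => (abs_le.1 (h i)).1, fun i => (abs_le.1 (h i)).2⟩
    rw [hfar x i hi, Int.units_mul_self]

namespace IsContourSpin

variable {σ : Config d} {γ : Finset (Site d)} {s : Config d}

theorem eq_of_adj (h : IsContourSpin σ γ s) {x y : Site d} (hxy : (lattice d).Adj x y)
    (hx : x ∉ γ) : s x = s y := by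
  have := h.edge x y hxy
  rw [if_neg hx] at this
  exact units_mul_eq_one_iff.1 this

theorem eq_of_adj_of_notMem (h : IsContourSpin σ γ s) (x y : Site d) (hxy : (lattice d).Adj x y)
    (hx : x ∉ (γ : Set (Site d))) (_ : y ∉ (γ : Set (Site d))) : s x = s y :=
  h.eq_of_adj hxy (by simpa using hx)

theorem mem_of_ne (h : IsContourSpin σ γ s) {x y : Site d} (hxy : (lattice d).Adj x y)
    (hs : s x ≠ s y) : x ∈ γ := by
  by_contra hx
  exact hs (h.eq_of_adj hxy hx)

theorem eq_of_mem_component (h : IsContourSpin σ γ s) {x y : Site d}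
    (hy : y ∈ component (γ : Set (Site d))ᶜ x) : s x = s y :=
  LongRangeIsing.eq_of_mem_component h.eq_of_adj_of_notMem hy

/-- A contour spin is `1` outside the volume of the contour. -/
theorem eq_one_of_notMem_volume (h : IsContourSpin σ γ s) {x : Site d}
    (hx : x ∉ volume (γ : Set (Site d))) : s x = 1 := by
  by_contra hs
  refine hx (Or.inr ⟨fun hxγ => hx (Or.inl hxγ), h.finite.subset fun y hy => ?_⟩)
  rw [Set.mem_ofPred_eq, ← h.eq_of_mem_component hy]
  exact hs

end IsContourSpin

/-! ### Factorisation of a configuration into contour spins -/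

namespace IsContourPartition

variable {M a r : ℝ} {σ : Config d} {P : Finset (Finset (Site d))}
  {s : Finset (Site d) → Config d}

theorem two_lt_l1dist (hP : IsContourPartition M a r σ P) (hM : 2 ≤ M) (ha : 0 ≤ a)
    {γ γ' : Finset (Site d)} (hγ : γ ∈ P) (hγ' : γ' ∈ P) (hne : γ ≠ γ') {x y : Site d}
    (hx : x ∈ γ) (hy : y ∈ γ') : 2 < l1dist x y := by
  obtain ⟨pieces, -, hsep⟩ := hP.separated
  have h := hsep γ hγ γ' hγ' hne x hx y hy
  have h1 : (1 : ℝ) ≤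
      ((max 1 (min (maxDiam (pieces γ)) (maxDiam (pieces γ'))) : ℕ) : ℝ) ^ a :=
    Real.one_le_rpow (by exact_mod_cast le_max_left _ _) ha
  have : (2 : ℝ) < l1dist x y := by nlinarith
  exact_mod_cast this

theorem mem_of_l1dist_le (hP : IsContourPartition M a r σ P) (hM : 2 ≤ M) (ha : 0 ≤ a)
    {γ : Finset (Site d)} (hγ : γ ∈ P) {x y : Site d} (hx : x ∈ γ) (hy : y ∈ boundary σ)
    (hxy : l1dist x y ≤ 2) : y ∈ γ := by
  obtain ⟨γ', hγ', hyγ'⟩ := (hP.cover y).1 hy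
  by_cases hne : γ = γ'
  · rwa [hne]
  · exact absurd (hP.two_lt_l1dist hM ha hγ hγ' hne hx hyγ') (by omega)

theorem exists_contourSpins (hP : IsContourPartition M a r σ P) (hd : 2 ≤ d) (hM : 2 ≤ M)
    (ha : 0 ≤ a) : ∃ s : Finset (Site d) → Config d, ∀ γ ∈ P, IsContourSpin σ γ (s γ) := by
  have h : ∀ γ, ∃ s, γ ∈ P → IsContourSpin σ γ s := fun γ => by
    by_cases hγ : γ ∈ P
    · obtain ⟨s, hs⟩ := exists_contourSpin hd σ γ
        fun x hx y hy hxy => hP.mem_of_l1dist_le hM ha hγ hx hy hxy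
      exact ⟨s, fun _ => hs⟩
    · exact ⟨fun _ => 1, fun h => absurd h hγ⟩
  choose s hs using h
  exact ⟨s, hs⟩

theorem notMem_of_mem (hP : IsContourPartition M a r σ P) {γ γ' : Finset (Site d)} (hγ : γ ∈ P)
    (hγ' : γ' ∈ P) (hne : γ ≠ γ') {x : Site d} (hx : x ∈ γ) : x ∉ γ' :=
  Finset.disjoint_left.1 (hP.disjoint γ hγ γ' hγ' hne) hx

/-- A configuration is the product of the spins of its contours. -/
theorem eq_prod_contourSpin (hP : IsContourPartition M a r σ P) (hd : 0 < d)
    (hs : ∀ γ ∈ P, IsContourSpin σ γ (s γ)) (hσ : {x | σ x ≠ 1}.Finite) (x : Site d) :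
    σ x = ∏ γ ∈ P, s γ x := by
  -- The quotient of the two sides changes across no edge, and far away all factors are `1`.
  have hconst := eq_of_adj_eq (s := fun x => σ x * ∏ γ ∈ P, s γ x) (fun x y hxy => by
    rw [← units_mul_eq_one_iff, mul_mul_mul_comm, ← Finset.prod_mul_distrib,
      units_mul_eq_one_iff,
      Finset.prod_congr rfl fun γ hγ => (hs γ hγ).edge x y hxy]
    by_cases hx : ∃ γ ∈ P, x ∈ γ
    · obtain ⟨γ, hγ, hxγ⟩ := hx
      rw [Finset.prod_eq_single_of_mem γ hγ fun γ' hγ' hne =>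
        if_neg (hP.notMem_of_mem hγ hγ' hne.symm hxγ), if_pos hxγ]
    · rw [Finset.prod_eq_one fun γ hγ => if_neg fun h => hx ⟨γ, hγ, h⟩, units_mul_eq_one_iff]
      by_contra hne
      exact hx ((hP.cover x).1 ⟨y, hxy, fun h => hne h.symm⟩))
  have hfin : ({x | σ x ≠ 1} ∪ ⋃ γ ∈ P, {x | s γ x ≠ 1}).Finite :=
    hσ.union (Set.Finite.biUnion P.finite_toSet fun γ hγ => (hs γ hγ).finite)
  have : Nonempty (Fin d) := ⟨⟨0, hd⟩⟩
  obtain ⟨z, hz⟩ := hfin.exists_notMem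
  simp only [Set.mem_union, Set.mem_ofPred_eq, Set.mem_iUnion, not_or, not_exists, not_not] at hz
  have h1 := hconst x z
  rw [hz.1, Finset.prod_eq_one fun γ hγ => hz.2 γ hγ, mul_one] at h1
  exact units_mul_eq_one_iff.1 h1

/-- The spin of a contour is constant on every other contour. -/
theorem contourSpin_eq (hP : IsContourPartition M a r σ P)
    (hs : ∀ γ ∈ P, IsContourSpin σ γ (s γ)) {γ γ' : Finset (Site d)} (hγ : γ ∈ P) (hγ' : γ' ∈ P)
    (hne : γ' ≠ γ) {x y : Site d} (hx : x ∈ γ) (hy : y ∈ γ) : s γ' x = s γ' y := by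
  obtain ⟨z, hz⟩ := hP.one_component γ' hγ' γ hγ hne
  exact ((hs γ' hγ').eq_of_mem_component (hz hx)).symm.trans
    ((hs γ' hγ').eq_of_mem_component (hz hy))

theorem exists_adj_contourSpin_ne (hP : IsContourPartition M a r σ P)
    (hs : ∀ γ ∈ P, IsContourSpin σ γ (s γ)) {γ : Finset (Site d)} (hγ : γ ∈ P) {x : Site d}
    (hx : x ∈ γ) : ∃ y, (lattice d).Adj x y ∧ s γ x ≠ s γ y := by
  obtain ⟨y, hxy, hne⟩ := (hP.cover x).2 ⟨γ, hγ, hx⟩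
  refine ⟨y, hxy, fun h => hne ?_⟩
  have := (hs γ hγ).edge x y hxy
  rw [if_pos hx, h, Int.units_mul_self] at this
  exact (units_mul_eq_one_iff.1 this.symm).symm

theorem exists_contourSpin_ne_one (hP : IsContourPartition M a r σ P)
    (hs : ∀ γ ∈ P, IsContourSpin σ γ (s γ)) {γ : Finset (Site d)} (hγ : γ ∈ P) :
    ∃ x, s γ x ≠ 1 := by
  obtain ⟨x, hx⟩ := hP.nonempty γ hγ
  obtain ⟨y, -, hne⟩ := hP.exists_adj_contourSpin_ne hs hγ hx
  by_contra! h
  exact hne ((h x).trans (h y).symm)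

/-- Next to a contour, the spin is that of the contour times that of the environment. -/
theorem eq_mul_prod_erase (hP : IsContourPartition M a r σ P) (hd : 0 < d)
    (hs : ∀ γ ∈ P, IsContourSpin σ γ (s γ)) (hσ : {x | σ x ≠ 1}.Finite) {γ : Finset (Site d)}
    (hγ : γ ∈ P) {x y g : Site d} (hx : x ∈ γ) (hxy : (lattice d).Adj x y) (hg : g ∈ γ) :
    σ y = s γ y * ∏ γ' ∈ P.erase γ, s γ' g := by
  rw [hP.eq_prod_contourSpin hd hs hσ y, ← Finset.mul_prod_erase P _ hγ]
  congr 1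
  refine Finset.prod_congr rfl fun γ' hγ' => ?_
  rw [Finset.mem_erase] at hγ'
  rw [← (hs γ' hγ'.2).eq_of_adj hxy (hP.notMem_of_mem hγ hγ'.2 hγ'.1.symm hx)]
  exact hP.contourSpin_eq hs hγ hγ'.2 hγ'.1 hx hg

/-- The environment of a contour with label `1` is `1`. -/
theorem prod_erase_eq_one (hP : IsContourPartition M a r σ P) (hd : 0 < d)
    (hs : ∀ γ ∈ P, IsContourSpin σ γ (s γ)) (hσ : {x | σ x ≠ 1}.Finite) {γ : Finset (Site d)}
    (hγ : γ ∈ P) (hlabel : HasLabel σ γ 1) {g : Site d} (hg : g ∈ γ) :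
    ∏ γ' ∈ P.erase γ, s γ' g = 1 := by
  -- At an edge leaving the volume, the label gives `σ y = 1` and also `s γ y = 1`, so the
  -- environment must be `1`.
  obtain ⟨x, hx, y, hy, hxy⟩ := exists_boundary_edge (A := volume (γ : Set (Site d)))
    ⟨g, Or.inl hg⟩ (volume_ne_univ hd γ.finite_toSet)
  have hxγ : x ∈ γ := mem_of_adj_of_mem_volume hx hy hxy
  have h := hP.eq_mul_prod_erase hd hs hσ hγ hxγ hxy hg
  rw [hlabel y ⟨hy, x, hx, hxy.symm⟩, (hs γ hγ).eq_one_of_notMem_volume hy, one_mul] at h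
  exact h.symm

/-- For a contour with label `1`, the part of the inside with label `-1` is where the spin of the
contour is negative. -/
theorem mem_labelledInside_iff (hP : IsContourPartition M a r σ P) (hd : 0 < d)
    (hs : ∀ γ ∈ P, IsContourSpin σ γ (s γ)) (hσ : {x | σ x ≠ 1}.Finite) {γ : Finset (Site d)}
    (hγ : γ ∈ P) (hlabel : HasLabel σ γ 1) (x : Site d) :
    x ∈ labelledInside σ γ (-1) ↔ x ∉ γ ∧ s γ x ≠ 1 := by
  obtain ⟨g, hg⟩ := hP.nonempty γ hγ
  -- These points are adjacent to `γ`, where the environment is `1`, and `s γ` is constant on the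
  -- component.
  have hval : ∀ y ∈ innerBoundary (volume (component ((γ : Set (Site d))ᶜ) x)), σ y = s γ x := by
    rintro y ⟨hy, z, hz, hyz⟩
    have hyC := mem_of_adj_of_mem_volume hy hz hyz
    have hzγ : z ∈ γ := by
      by_contra hzγ
      exact hz (Or.inl (mem_component_of_adj hyC (by simpa using hzγ) hyz))
    rw [hP.eq_mul_prod_erase hd hs hσ hγ hzγ hyz.symm hg,
      hP.prod_erase_eq_one hd hs hσ hγ hlabel hg, mul_one]
    exact ((hs γ hγ).eq_of_mem_component hyC).symm
  constructor
  · rintro ⟨hx, h⟩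
    refine ⟨hx.1, ?_⟩
    obtain ⟨y, hy, z, hz, hyz⟩ := exists_boundary_edge
      (A := volume (component ((γ : Set (Site d))ᶜ) x)) ⟨x, Or.inl (mem_component_self hx.1)⟩
      (volume_ne_univ hd hx.2)
    rw [← hval y ⟨hy, z, hz, hyz⟩, h y ⟨hy, z, hz, hyz⟩]
    decide
  · rintro ⟨hx, h⟩
    refine ⟨?_, fun y hy => ?_⟩
    · by_contra hin
      exact h ((hs γ hγ).eq_one_of_notMem_volume (by rintro (h | h); exacts [hx h, hin h]))
    · rw [hval y hy]
      exact (Int.units_eq_one_or _).resolve_left h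

end IsContourPartition

namespace IsExternalFamily

variable {M a r : ℝ} {σ : Config d} {Λ : Finset (Site d)} {P Γ : Finset (Finset (Site d))}
  {s : Finset (Site d) → Config d} {c : ℤˣ}

/-- `s γ'` is constant on `γ`, and some point of `γ` lies outside the volume of `γ'`, where `s γ'`
is `1`. -/
theorem contourSpin_eq_one_of_mem (hΓ : IsExternalFamily Λ σ P Γ c)
    (hP : IsContourPartition M a r σ P) (hs : ∀ γ ∈ P, IsContourSpin σ γ (s γ))
    {γ γ' : Finset (Site d)} (hγ : γ ∈ Γ) (hγ' : γ' ∈ Γ) (hne : γ' ≠ γ) {x : Site d}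
    (hx : x ∈ γ) : s γ' x = 1 := by
  obtain ⟨y, hy, hyV⟩ := Set.not_subset.1 (hΓ.external γ hγ γ' hγ' hne.symm)
  rw [hP.contourSpin_eq hs (hΓ.subset hγ) (hΓ.subset hγ') hne hx hy]
  exact (hs γ' (hΓ.subset hγ')).eq_one_of_notMem_volume hyV

/-- The spins of two contours that are external to each other are not both negative. -/
theorem contourSpin_eq_one_of_ne_one (hΓ : IsExternalFamily Λ σ P Γ c)
    (hP : IsContourPartition M a r σ P) (hs : ∀ γ ∈ P, IsContourSpin σ γ (s γ)) (hd : 0 < d)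
    {γ γ' : Finset (Site d)} (hγ : γ ∈ Γ) (hγ' : γ' ∈ Γ) (hne : γ' ≠ γ) {x : Site d}
    (hx : s γ x ≠ 1) : s γ' x = 1 := by
  by_contra hx'
  have : Nonempty (Fin d) := ⟨⟨0, hd⟩⟩
  -- On an edge leaving the common negative region one of the spins changes, so `u` lies on that
  -- contour, where the other spin is `1`.
  obtain ⟨u, hu, v, hv, huv⟩ := exists_boundary_edge (A := {x | s γ x ≠ 1} ∩ {x | s γ' x ≠ 1})
    ⟨x, hx, hx'⟩ (fun h => Set.infinite_univ
      (h ▸ (hs γ (hΓ.subset hγ)).finite.subset Set.inter_subset_left))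
  by_cases hv1 : s γ v = 1
  · have huγ : u ∈ γ := (hs γ (hΓ.subset hγ)).mem_of_ne huv (by rw [hv1]; exact hu.1)
    exact hu.2 (hΓ.contourSpin_eq_one_of_mem hP hs hγ hγ' hne huγ)
  · have hv2 : s γ' v = 1 := by
      by_contra h
      exact hv ⟨hv1, h⟩
    have huγ : u ∈ γ' := (hs γ' (hΓ.subset hγ')).mem_of_ne huv (by rw [hv2]; exact hu.2)
    exact hu.1 (hΓ.contourSpin_eq_one_of_mem hP hs hγ' hγ hne.symm huγ)

/-- The flip multiplies a configuration by the spins of the flipped contours. -/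
theorem contourFlip_eq_mul (hΓ : IsExternalFamily Λ σ P Γ 1)
    (hP : IsContourPartition M a r σ P) (hs : ∀ γ ∈ P, IsContourSpin σ γ (s γ)) (hd : 0 < d)
    (hσ : {x | σ x ≠ 1}.Finite) (x : Site d) :
    contourFlip Γ σ x = σ x * ∏ γ ∈ Γ, s γ x := by
  unfold contourFlip
  split_ifs with h1 h2
  · obtain ⟨γ, hγ, hx⟩ := h1
    rw [Finset.prod_eq_single_of_mem γ hγ fun γ' hγ' hne =>
      hΓ.contourSpin_eq_one_of_mem hP hs hγ hγ' hne hx, hP.eq_prod_contourSpin hd hs hσ x,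
      ← Finset.mul_prod_erase P _ (hΓ.subset hγ),
      hP.prod_erase_eq_one hd hs hσ (hΓ.subset hγ) (hΓ.label γ hγ) hx, mul_one,
      Int.units_mul_self]
  · obtain ⟨γ, hγ, hx⟩ := h2
    rw [hP.mem_labelledInside_iff hd hs hσ (hΓ.subset hγ) (hΓ.label γ hγ)] at hx
    rw [Finset.prod_eq_single_of_mem γ hγ fun γ' hγ' hne =>
      hΓ.contourSpin_eq_one_of_ne_one hP hs hd hγ hγ' hne hx.2,
      (Int.units_eq_one_or _).resolve_left hx.2]
    simp
  · rw [Finset.prod_eq_one, mul_one]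
    intro γ hγ
    by_contra h
    refine h2 ⟨γ, hγ, ?_⟩
    rw [hP.mem_labelledInside_iff hd hs hσ (hΓ.subset hγ) (hΓ.label γ hγ)]
    exact ⟨fun hx => h1 ⟨γ, hγ, hx⟩, h⟩

end IsExternalFamily

/-! ### Size of the negative region of a contour spin -/

theorem l1dist_le_maxDiam {F : Finset (Finset (Site d))} {A : Finset (Site d)} (hA : A ∈ F)
    {x y : Site d} (hx : x ∈ A) (hy : y ∈ A) : l1dist x y ≤ maxDiam F :=
  (Finset.le_sup (f := fun p : Site d × Site d => l1dist p.1 p.2)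
    (Finset.mk_mem_product hx hy)).trans (Finset.le_sup (f := diam) hA)

/-- Each piece projects into an interval of length `maxDiam F`. So a contour misses one of any
slightly larger number of parallel hyperplanes. -/
theorem card_image_coord_le (F : Finset (Finset (Site d))) (i : Fin d) :
    ((F.sup id).image fun x => x i).card ≤ F.card * (maxDiam F + 1) := by
  have hsub : (F.sup id).image (fun x => x i) ⊆ F.biUnion fun A => A.image fun x => x i := by
    intro t ht
    obtain ⟨x, hx, rfl⟩ := Finset.mem_image.1 ht
    obtain ⟨A, hA, hxA⟩ := Finset.mem_sup.1 hx
    exact Finset.mem_biUnion.2 ⟨A, hA, Finset.mem_image_of_mem _ hxA⟩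
  refine (Finset.card_le_card hsub).trans (Finset.card_biUnion_le_card_mul _ _ _ fun A hA => ?_)
  rcases (A.image fun x => x i).eq_empty_or_nonempty with h | h
  · simp [h]
  obtain ⟨p, hp, hpm⟩ := Finset.mem_image.1 (Finset.min'_mem _ h)
  have : A.image (fun x => x i) ⊆ Finset.Icc (p i) (p i + maxDiam F) := by
    intro t ht
    have hle := Finset.min'_le _ t ht
    obtain ⟨q, hq, rfl⟩ := Finset.mem_image.1 ht
    have h1 := natAbs_sub_le_l1dist p q i
    have h2 := l1dist_le_maxDiam hA hp hq
    rw [Finset.mem_Icc]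
    omega
  refine (Finset.card_le_card this).trans ?_
  rw [Int.card_Icc]
  omega

theorem card_l1ball_le (p : Site d) (R : ℕ) (A : Finset (Site d))
    (hA : ∀ x ∈ A, l1dist x p ≤ R) : A.card ≤ (2 * R + 1) ^ d := by
  have : A ⊆ Finset.Icc (fun i => p i - R) (fun i => p i + R) := by
    intro x hx
    rw [Finset.mem_Icc]
    have h := hA x hx
    constructor <;> intro i <;> have := natAbs_sub_le_l1dist x p i <;> simp only <;> omega
  refine (Finset.card_le_card this).trans ?_
  rw [Pi.card_Icc]
  refine le_of_eq ?_
  rw [Finset.prod_congr rfl fun i _ => show _ = 2 * R + 1 by rw [Int.card_Icc]; omega]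
  simp

namespace IsContourSpin

variable {σ : Config d} {γ : Finset (Site d)} {s : Config d} {F : Finset (Finset (Site d))}

/-- Every point with a negative contour spin is close to the contour. -/
theorem exists_l1dist_le (h : IsContourSpin σ γ s) (hd : 2 ≤ d) (hF : F.sup id = γ) {x : Site d}
    (hx : s x ≠ 1) : ∃ p ∈ γ, l1dist x p ≤ F.card * (maxDiam F + 1) := by
  by_contra! hfar
  set m := F.card * (maxDiam F + 1) with hm
  set i₀ : Fin d := ⟨0, by omega⟩
  set i₁ : Fin d := ⟨1, by omega⟩
  have h01 : i₁ ≠ i₀ := by simp [i₀, i₁]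
  -- Pigeonhole: `γ` meets at most `m` of these `m + 1` hyperplanes. Moving from `x` to a free one
  -- stays within distance `m` of `x`, hence off `γ`; that hyperplane is infinite, which contradicts
  -- finiteness of the negative region.
  obtain ⟨t, ht, htγ⟩ : ∃ t ∈ (Finset.range (m + 1)).image (fun t : ℕ => x i₀ + (t : ℤ)),
      t ∉ γ.image fun y => y i₀ := by
    refine Finset.exists_mem_notMem_of_card_lt_card ?_
    have hinj : Function.Injective fun t : ℕ => x i₀ + (t : ℤ) := fun t t' htt => by
      simpa using htt
    rw [Finset.card_image_of_injective _ hinj, Finset.card_range, ← hF]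
    exact Nat.lt_succ_of_le (card_image_coord_le F i₀)
  obtain ⟨t, htm, rfl⟩ := Finset.mem_image.1 ht
  rw [Finset.mem_range] at htm
  set y := Function.update x i₀ (x i₀ + t) with hy
  have hxy : s x = s y := by
    have hdist : l1dist x y ≤ m := by
      have := l1dist_update x i₀ (x i₀) (x i₀ + t)
      rw [Function.update_eq_self] at this
      rw [hy, this]
      omega
    refine eq_of_l1dist h.eq_of_adj_of_notMem x y fun z hz hzγ => ?_
    have := hfar z hzγ
    omega
  refine infinite_of_segments y i₁ (A := {x | s x ≠ 1}) (fun u => ?_) h.finite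
  have : s y = s (Function.update y i₁ (y i₁ + u)) := by
    refine eq_of_hyperplane h.eq_of_adj_of_notMem y _ i₀ (by rw [Function.update_of_ne h01.symm])
      fun z hz hzγ => htγ ?_
    rw [hy, Function.update_self] at hz
    exact Finset.mem_image.2 ⟨z, hzγ, hz⟩
  rw [Set.mem_ofPred_eq, ← this, ← hxy]
  exact hx

/-- The negative region is covered by one ball per piece: its points are within `m` of some piece,
and a piece adds at most its diameter. -/
theorem ncard_le (h : IsContourSpin σ γ s) (hd : 2 ≤ d) (hF : F.sup id = γ) :
    {x | s x ≠ 1}.ncard ≤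
      F.card * (2 * (maxDiam F + F.card * (maxDiam F + 1)) + 1) ^ d := by
  classical
  set m := F.card * (maxDiam F + 1) with hm
  set N := h.finite.toFinset
  rw [Set.ncard_eq_toFinset_card _ h.finite]
  have hsub : N ⊆ F.biUnion fun A => N.filter fun x => ∃ p ∈ A, l1dist x p ≤ m := by
    intro x hx
    obtain ⟨p, hp, hxp⟩ := h.exists_l1dist_le hd hF (h.finite.mem_toFinset.1 hx)
    rw [← hF] at hp
    obtain ⟨A, hA, hpA⟩ := Finset.mem_sup.1 hp
    exact Finset.mem_biUnion.2 ⟨A, hA, Finset.mem_filter.2 ⟨hx, p, hpA, hxp⟩⟩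
  refine (Finset.card_le_card hsub).trans (Finset.card_biUnion_le_card_mul _ _ _ fun A hA => ?_)
  rcases A.eq_empty_or_nonempty with rfl | ⟨q, hq⟩
  · simp
  refine card_l1ball_le q _ _ fun x hx => ?_
  obtain ⟨-, p, hp, hxp⟩ := Finset.mem_filter.1 hx
  have h1 := l1dist_triangle x p q
  have h2 := l1dist_le_maxDiam hA hp hq
  omega

end IsContourSpin

/-! ### Couplings and energies of sets of pairs -/

theorem coupling_nonneg {J : ℝ} (hJ : 0 ≤ J) (α : ℝ) (x y : Site d) : 0 ≤ coupling J α x y := by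
  unfold coupling
  split_ifs
  · exact le_rfl
  · positivity

theorem coupling_comm (J α : ℝ) (x y : Site d) : coupling J α x y = coupling J α y x := by
  unfold coupling
  rw [l1dist_comm x y]
  simp only [eq_comm]

theorem coupling_of_adj (J α : ℝ) {x y : Site d} (h : (lattice d).Adj x y) :
    coupling J α x y = J := by
  have h1 : l1dist x y = 1 := h
  rw [coupling, if_neg h.ne, h1]
  simp

theorem coupling_eq {α : ℝ} (hα : α ≠ 0) (J : ℝ) (x y : Site d) :
    coupling J α x y = J * (l1dist x y : ℝ) ^ (-α) := by
  unfold coupling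
  split_ifs with h
  · rw [l1dist_eq_zero.2 h, Nat.cast_zero, Real.zero_rpow (neg_ne_zero.2 hα), mul_zero]
  · rfl

theorem l1dist_add_right (x y z : Site d) : l1dist (x + z) (y + z) = l1dist x y := by
  simp [l1dist]

theorem norm_le_l1dist (x : Site d) : ‖(fun i => (x i : ℝ) : Fin d → ℝ)‖ ≤ l1dist x 0 := by
  refine (pi_norm_le_iff_of_nonneg (Nat.cast_nonneg _)).2 fun i => ?_
  have h := natAbs_sub_le_l1dist x 0 i
  rw [Pi.zero_apply, sub_zero] at h
  rw [Real.norm_eq_abs, ← Int.cast_abs, Int.abs_eq_natAbs, Int.cast_natCast]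
  exact_mod_cast h

/-- Comparison with the sup norm on the lattice spanned by the standard basis, whose powers below
minus the rank are summable. -/
theorem summable_l1dist_rpow {β : ℝ} (hβ : (d : ℝ) < β) :
    Summable fun x : Site d => (l1dist x 0 : ℝ) ^ (-β) := by
  have hβ0 : 0 < β := lt_of_le_of_lt (Nat.cast_nonneg d) hβ
  set L : Submodule ℤ (Fin d → ℝ) := Submodule.span ℤ (Set.range (Pi.basisFun ℝ (Fin d)))
  have hrank : Module.finrank ℤ L = d := by
    rw [ZLattice.rank ℝ L]; simp
  have hsum := ZLattice.summable_norm_rpow L (-β) (by rw [hrank]; linarith)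
  have hmem : ∀ x : Site d, (fun i => (x i : ℝ)) ∈ L := fun x => by
    rw [Module.Basis.mem_span_iff_repr_mem]
    exact fun i => ⟨x i, by simp⟩
  let φ : Site d → L := fun x => ⟨fun i => (x i : ℝ), hmem x⟩
  have hφ : Function.Injective φ := fun x y h => by
    funext i
    have h' : (x i : ℝ) = y i := congrFun (congrArg Subtype.val h) i
    exact_mod_cast h'
  refine Summable.of_nonneg_of_le (fun _ => by positivity) (fun x => ?_)
    (hsum.comp_injective hφ)
  by_cases hx : x = 0
  · subst hx
    rw [l1dist_self, Nat.cast_zero, Real.zero_rpow (by linarith)]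
    exact Real.rpow_nonneg (norm_nonneg _) _
  · refine Real.rpow_le_rpow_of_nonpos ?_ (norm_le_l1dist x) (by linarith)
    refine norm_pos_iff.2 fun h0 => hx ?_
    funext i
    have h' : (x i : ℝ) = 0 := congrFun (congrArg Subtype.val h0) i
    exact_mod_cast h'

theorem tsum_l1dist_eq (f : ℕ → ℝ≥0∞) (x : Site d) :
    ∑' y, f (l1dist x y) = ∑' y : Site d, f (l1dist y 0) := by
  rw [← (Equiv.addRight x).tsum_eq fun y => f (l1dist x y)]
  refine tsum_congr fun y => ?_
  have := l1dist_add_right 0 y x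
  rw [zero_add] at this
  rw [Equiv.coe_addRight, this, l1dist_comm]

/-- The sum of `|x - y|^{-β}` over `y`. -/
noncomputable def latticeSum (d : ℕ) (β : ℝ) : ℝ := ∑' x : Site d, (l1dist x 0 : ℝ) ^ (-β)

theorem latticeSum_nonneg (d : ℕ) (β : ℝ) : 0 ≤ latticeSum d β :=
  tsum_nonneg fun _ => by positivity

theorem tsum_ofReal_l1dist_rpow {β : ℝ} (hβ : (d : ℝ) < β) (x : Site d) :
    ∑' y, ENNReal.ofReal ((l1dist x y : ℝ) ^ (-β)) = ENNReal.ofReal (latticeSum d β) := by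
  rw [tsum_l1dist_eq (fun n => ENNReal.ofReal ((n : ℝ) ^ (-β))) x, latticeSum,
    ENNReal.ofReal_tsum_of_nonneg (fun _ => by positivity) (summable_l1dist_rpow hβ)]

/-- The couplings as extended non-negative reals. -/
noncomputable def ecoupling (J α : ℝ) (x y : Site d) : ℝ≥0∞ := ENNReal.ofReal (coupling J α x y)

theorem ecoupling_comm (J α : ℝ) (x y : Site d) : ecoupling J α x y = ecoupling J α y x := by
  rw [ecoupling, coupling_comm, ecoupling]

theorem ecoupling_ne_top (J α : ℝ) (x y : Site d) : ecoupling J α x y ≠ ∞ := ENNReal.ofReal_ne_top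

theorem toReal_ecoupling {J : ℝ} (hJ : 0 ≤ J) (α : ℝ) (x y : Site d) :
    (ecoupling J α x y).toReal = coupling J α x y :=
  ENNReal.toReal_ofReal (coupling_nonneg hJ α x y)

theorem tsum_ecoupling {α : ℝ} (hα : (d : ℝ) < α) {J : ℝ} (hJ : 0 ≤ J) (x : Site d) :
    ∑' y, ecoupling J α x y = ENNReal.ofReal (J * latticeSum d α) := by
  have hα0 : α ≠ 0 := (lt_of_le_of_lt (Nat.cast_nonneg d) hα).ne'
  simp only [ecoupling, coupling_eq hα0, ENNReal.ofReal_mul hJ]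
  rw [ENNReal.tsum_mul_left, tsum_ofReal_l1dist_rpow hα]

/-- The couplings of a site to the sites at distance at least `R` decay in `R`. -/
theorem tsum_ecoupling_far_le {α β : ℝ} (hβ : (d : ℝ) < β) (hβα : β ≤ α) {J : ℝ} (hJ : 0 ≤ J)
    {R : ℝ} (hR : 0 < R) (x : Site d) (p : Site d → Prop) {_ : DecidablePred p}
    (hp : ∀ y, p y → R ≤ l1dist x y) :
    ∑' y, (if p y then ecoupling J α x y else 0) ≤
      ENNReal.ofReal (J * R ^ (β - α) * latticeSum d β) := by
  have hα0 : α ≠ 0 := (lt_of_le_of_lt (Nat.cast_nonneg d) (hβ.trans_le hβα)).ne'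
  have h0 : 0 ≤ J * R ^ (β - α) := by positivity
  rw [ENNReal.ofReal_mul h0, ← tsum_ofReal_l1dist_rpow hβ x, ← ENNReal.tsum_mul_left]
  refine ENNReal.tsum_le_tsum fun y => ?_
  split_ifs with h
  · rw [← ENNReal.ofReal_mul h0, ecoupling, coupling_eq hα0]
    refine ENNReal.ofReal_le_ofReal ?_
    rw [mul_assoc]
    refine mul_le_mul_of_nonneg_left ?_ hJ
    have hd := hp y h
    have hpos : (0 : ℝ) < l1dist x y := hR.trans_le hd
    rw [show -α = (β - α) + -β by ring, Real.rpow_add hpos]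
    exact mul_le_mul_of_nonneg_right (Real.rpow_le_rpow_of_nonpos hR hd (by linarith))
      (by positivity)
  · exact zero_le

open Classical in
/-- The sum of the couplings over all ordered pairs in the relation `R`. -/
noncomputable def pairEnergy (J α : ℝ) (R : Site d → Site d → Prop) : ℝ≥0∞ :=
  ∑' x, ∑' y, if R x y then ecoupling J α x y else 0

section pairEnergy

variable {J α : ℝ} {R R₁ R₂ : Site d → Site d → Prop}

theorem pairEnergy_mono (h : ∀ x y, R₁ x y → R₂ x y) : pairEnergy J α R₁ ≤ pairEnergy J α R₂ := by
  refine ENNReal.tsum_le_tsum fun x => ENNReal.tsum_le_tsum fun y => ?_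
  by_cases h1 : R₁ x y
  · rw [if_pos h1, if_pos (h x y h1)]
  · rw [if_neg h1]; exact zero_le

theorem pairEnergy_or_le (R₁ R₂ : Site d → Site d → Prop) :
    pairEnergy J α (fun x y => R₁ x y ∨ R₂ x y) ≤ pairEnergy J α R₁ + pairEnergy J α R₂ := by
  unfold pairEnergy
  simp only [← ENNReal.tsum_add]
  refine ENNReal.tsum_le_tsum fun x => ENNReal.tsum_le_tsum fun y => ?_
  by_cases h1 : R₁ x y <;> by_cases h2 : R₂ x y <;> simp [h1, h2]

theorem pairEnergy_exists_le {ι : Type*} (P : Finset ι) (R : ι → Site d → Site d → Prop) :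
    pairEnergy J α (fun x y => ∃ i ∈ P, R i x y) ≤ ∑ i ∈ P, pairEnergy J α (R i) := by
  classical
  induction P using Finset.induction_on with
  | empty => simp [pairEnergy]
  | insert i P hi ih =>
    rw [Finset.sum_insert hi]
    refine (pairEnergy_mono fun x y h => ?_).trans
      ((pairEnergy_or_le (R i) fun x y => ∃ i ∈ P, R i x y).trans (by gcongr))
    obtain ⟨j, hj, h⟩ := h
    rcases Finset.mem_insert.1 hj with rfl | hj
    · exact Or.inl h
    · exact Or.inr ⟨j, hj, h⟩

theorem pairEnergy_swap : pairEnergy J α (fun x y => R y x) = pairEnergy J α R := by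
  unfold pairEnergy
  rw [ENNReal.tsum_comm]
  simp only [ecoupling_comm]

/-- Every pair on which a spin changes has its negative end first or second. -/
theorem pairEnergy_ne_le (s : Config d) : pairEnergy J α (fun x y => s x ≠ s y) ≤
    2 * pairEnergy J α (fun x y => s x ≠ 1 ∧ s y = 1) := by
  rw [two_mul]
  conv_rhs => arg 2; rw [← pairEnergy_swap]
  refine (pairEnergy_mono fun x y h => ?_).trans (pairEnergy_or_le _ _)
  rcases Int.units_eq_one_or (s x) with hx | hx <;>
    rcases Int.units_eq_one_or (s y) with hy | hy <;> simp_all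

theorem ofReal_le_pairEnergy {x y : Site d} (hxy : (lattice d).Adj x y) (h : R x y) :
    ENNReal.ofReal J ≤ pairEnergy J α R := by
  classical
  refine le_trans ?_ ((ENNReal.le_tsum y).trans (ENNReal.le_tsum x))
  rw [if_pos h, ecoupling, coupling_of_adj J α hxy]

/-- Pairs whose first member is in a finite set. -/
theorem pairEnergy_le_card {N : Set (Site d)} (hN : N.Finite) {c : ℝ≥0∞}
    (hR : ∀ x y, R x y → x ∈ N)
    (hc : open Classical in ∀ x ∈ N, ∑' y, (if R x y then ecoupling J α x y else 0) ≤ c) :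
    pairEnergy J α R ≤ N.ncard * c := by
  classical
  have h0 : ∀ x ∉ hN.toFinset, ∑' y, (if R x y then ecoupling J α x y else 0) = 0 := by
    intro x hx
    rw [ENNReal.tsum_eq_zero]
    exact fun y => if_neg fun h => hx (hN.mem_toFinset.2 (hR x y h))
  unfold pairEnergy
  rw [tsum_eq_sum h0, Set.ncard_eq_toFinset_card _ hN, ← nsmul_eq_mul]
  exact Finset.sum_le_card_nsmul _ _ _ fun x hx => by
    convert hc x (hN.mem_toFinset.1 hx)

theorem pairEnergy_le_card_mul (hα : (d : ℝ) < α) (hJ : 0 ≤ J) {N : Set (Site d)} (hN : N.Finite)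
    (hR : ∀ x y, R x y → x ∈ N) :
    pairEnergy J α R ≤ N.ncard * ENNReal.ofReal (J * latticeSum d α) := by
  refine pairEnergy_le_card hN hR fun x _ => ?_
  rw [← tsum_ecoupling hα hJ x]
  exact ENNReal.tsum_le_tsum fun y => by split_ifs <;> simp

theorem pairEnergy_ne_top (hα : (d : ℝ) < α) (hJ : 0 ≤ J) {N : Set (Site d)} (hN : N.Finite)
    (hR : ∀ x y, R x y → x ∈ N) : pairEnergy J α R ≠ ∞ :=
  ne_top_of_le_ne_top (by finiteness) (pairEnergy_le_card_mul hα hJ hN hR)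

theorem surfaceEnergy_eq (hα : (d : ℝ) < α) (hJ : 0 ≤ J) (A : Set (Site d)) :
    surfaceEnergy J α A = (pairEnergy J α fun x y => x ∈ A ∧ y ∉ A).toReal := by
  classical
  have hinner : ∀ x : Site d, ∑' y : (Aᶜ : Set (Site d)), ecoupling J α x y ≠ ∞ := fun x =>
    ne_top_of_le_ne_top (b := ENNReal.ofReal (J * latticeSum d α)) (by finiteness) <| by
      rw [← tsum_ecoupling hα hJ x]
      exact ENNReal.tsum_comp_le_tsum_of_injective Subtype.val_injective _
  have e1 : ∀ x : Site d, ∑' y : (Aᶜ : Set (Site d)), coupling J α x y =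
      (∑' y : (Aᶜ : Set (Site d)), ecoupling J α x y).toReal := fun x => by
    rw [ENNReal.tsum_toReal_eq fun y : (Aᶜ : Set (Site d)) => ecoupling_ne_top J α x y]
    exact tsum_congr fun y => (toReal_ecoupling hJ α x y).symm
  unfold surfaceEnergy pairEnergy
  simp only [e1]
  rw [← ENNReal.tsum_toReal_eq fun x : A => hinner x,
    tsum_subtype A fun x => ∑' y : (Aᶜ : Set (Site d)), ecoupling J α x y]
  congr 1
  refine tsum_congr fun x => ?_
  by_cases hx : x ∈ A
  · rw [Set.indicator_of_mem hx, tsum_subtype Aᶜ fun y => ecoupling J α x y]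
    refine tsum_congr fun y => ?_
    by_cases hy : y ∈ A <;> simp [hx, hy]
  · simp [hx]

end pairEnergy

/-! ### Interaction between separated contours -/

/-- The geometric properties of a family of contour spins that bound the interaction between
different contours: `D γ` is the scale of `γ`, the region where `s γ` is negative stays within
distance `k * D γ` of `γ` and has at most `K * D γ ^ d` points, and every spin is constant near the
other contours. -/
structure IsSeparatedFamily (k K M a : ℝ) (P : Finset (Finset (Site d)))
    (s : Finset (Site d) → Config d) (D : Finset (Site d) → ℕ) : Prop where
  one_le : ∀ γ ∈ P, 1 ≤ D γ
  finite : ∀ γ ∈ P, {x | s γ x ≠ 1}.Finite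
  ncard_le : ∀ γ ∈ P, ({x | s γ x ≠ 1}.ncard : ℝ) ≤ K * (D γ : ℝ) ^ (d : ℝ)
  near : ∀ γ ∈ P, ∀ x, s γ x ≠ 1 → ∃ p ∈ γ, (l1dist x p : ℝ) ≤ k * D γ
  separated : ∀ γ ∈ P, ∀ γ' ∈ P, γ ≠ γ' → ∀ p ∈ γ, ∀ q ∈ γ',
    M * ((min (D γ) (D γ') : ℕ) : ℝ) ^ a < l1dist p q
  far : ∀ γ ∈ P, ∀ γ' ∈ P, γ ≠ γ' → ∀ p ∈ γ, ∀ w, s γ' w ≠ s γ' p →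
    M * ((min (D γ) (D γ') : ℕ) : ℝ) ^ a < l1dist p w

open Classical in
/-- The sum of the couplings of `x` to the sites where the spin differs from that at `x`. -/
noncomputable def siteEnergy (J α : ℝ) (s : Config d) (x : Site d) : ℝ≥0∞ :=
  ∑' y, if s x ≠ s y then ecoupling J α x y else 0

theorem tsum_siteEnergy (J α : ℝ) (s : Config d) :
    ∑' x, siteEnergy J α s x = pairEnergy J α fun x y => s x ≠ s y :=
  tsum_congr fun x => tsum_congr fun y => by by_cases h : s x = s y <;> simp [h]

/-- If `u` is no farther from `z` than any site `w` of different spin, then `|u - w| ≤ 2 |z - w|`,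
and the couplings compare up to `2 ^ α`. -/
theorem siteEnergy_le {J α : ℝ} (hJ : 0 ≤ J) (hα : 0 < α) {s : Config d} {z u : Site d}
    (hs : s u = s z) (h : ∀ w, s w ≠ s z → l1dist z u ≤ l1dist z w) :
    siteEnergy J α s z ≤ ENNReal.ofReal (2 ^ α) * siteEnergy J α s u := by
  unfold siteEnergy
  rw [← ENNReal.tsum_mul_left]
  refine ENNReal.tsum_le_tsum fun w => ?_
  by_cases hw : s z = s w
  · simp [hw, hs]
  rw [if_pos hw, if_pos (by rwa [hs]), ecoupling, ecoupling, ← ENNReal.ofReal_mul (by positivity),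
    coupling_eq hα.ne', coupling_eq hα.ne']
  refine ENNReal.ofReal_le_ofReal ?_
  have huw : u ≠ w := fun e => hw (by rw [← hs, e])
  have hpos : (0 : ℝ) < l1dist u w := by
    exact_mod_cast Nat.pos_of_ne_zero fun e => huw (l1dist_eq_zero.1 e)
  have hle : (l1dist u w : ℝ) ≤ 2 * l1dist z w := by
    have h1 := l1dist_triangle u z w
    have h2 := h w (Ne.symm hw)
    rw [l1dist_comm u z] at h1
    exact_mod_cast (by omega : l1dist u w ≤ 2 * l1dist z w)
  have h3 : (2 * (l1dist z w : ℝ)) ^ (-α) ≤ (l1dist u w : ℝ) ^ (-α) :=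
    Real.rpow_le_rpow_of_nonpos hpos hle (by linarith)
  rw [Real.mul_rpow (by norm_num) (Nat.cast_nonneg _), Real.rpow_neg (by norm_num)] at h3
  have h2 : (0 : ℝ) < 2 ^ α := by positivity
  rw [inv_mul_le_iff₀ h2] at h3
  calc J * (l1dist z w : ℝ) ^ (-α) ≤ J * (2 ^ α * (l1dist u w : ℝ) ^ (-α)) :=
        mul_le_mul_of_nonneg_left h3 hJ
    _ = 2 ^ α * (J * (l1dist u w : ℝ) ^ (-α)) := by ring

/-- The site energy is at most a multiple of its average over a short segment. -/
theorem siteEnergy_le_average {J α : ℝ} (hJ : 0 ≤ J) (hα : 0 < α) {s : Config d} {z : Site d}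
    (i : Fin d) {q : ℕ} (hq : q ≠ 0) (hs : ∀ t < q, s (z + Pi.single i (t : ℤ)) = s z)
    (h : ∀ w, s w ≠ s z → q ≤ l1dist z w + 1) :
    siteEnergy J α s z ≤ ENNReal.ofReal (2 ^ α / q) *
      ∑ t ∈ Finset.range q, siteEnergy J α s (z + Pi.single i (t : ℤ)) := by
  have hq' : (0 : ℝ) < q := by exact_mod_cast Nat.pos_of_ne_zero hq
  have key : q * siteEnergy J α s z ≤ ENNReal.ofReal (2 ^ α) *
      ∑ t ∈ Finset.range q, siteEnergy J α s (z + Pi.single i (t : ℤ)) := by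
    rw [Finset.mul_sum]
    calc (q : ℝ≥0∞) * siteEnergy J α s z
        = ∑ t ∈ Finset.range q, siteEnergy J α s z := by simp
      _ ≤ _ := Finset.sum_le_sum fun t ht => by
        rw [Finset.mem_range] at ht
        refine siteEnergy_le hJ hα (hs t ht) fun w hw => ?_
        rw [l1dist_add_single]
        have := h w hw
        omega
  rw [ENNReal.ofReal_div_of_pos hq', ENNReal.ofReal_natCast, ENNReal.div_eq_inv_mul, mul_assoc,
    ← ENNReal.mul_le_iff_le_inv (by simpa using hq) (by simp)]
  exact key

/-- Writing the segment sum as a sum over all sites `u` allows the sums over `z` and `u` to be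
exchanged later. -/
theorem sum_segment_le_tsum (f : Site d → ℝ≥0∞) (z : Site d) (i : Fin d) (q : ℕ)
    [DecidablePred fun u => ∃ t < q, u = z + Pi.single i (t : ℤ)] :
    ∑ t ∈ Finset.range q, f (z + Pi.single i (t : ℤ)) ≤
      ∑' u, if ∃ t < q, u = z + Pi.single i (t : ℤ) then f u else 0 := by
  have hinj : Function.Injective fun t : ℕ => z + Pi.single i (t : ℤ) := fun t t' h => by
    have := congrFun h i
    simpa using this
  refine le_trans ?_ ((ENNReal.sum_le_tsum (Finset.range q)).trans
    (ENNReal.tsum_comp_le_tsum_of_injective hinj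
      fun u => if ∃ t < q, u = z + Pi.single i (t : ℤ) then f u else 0))
  refine Finset.sum_le_sum fun t ht => le_of_eq ?_
  exact (if_pos ⟨t, Finset.mem_range.1 ht, rfl⟩).symm

namespace IsSeparatedFamily

variable {k K M a J α : ℝ} {P : Finset (Finset (Site d))} {s : Finset (Site d) → Config d}
  {D : Finset (Site d) → ℕ}

/-- The negative region reaches at most a quarter of the separation distance; the distance estimates
below spend such quarters. -/
theorem mul_scale_le (h : IsSeparatedFamily k K M a P s D) (hk : 0 ≤ k) (hM : 4 * k ≤ M)
    (ha : 1 ≤ a) {γ : Finset (Site d)} (hγ : γ ∈ P) : k * D γ ≤ M * (D γ : ℝ) ^ a / 4 := by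
  have h1 : (1 : ℝ) ≤ D γ := by exact_mod_cast h.one_le γ hγ
  have h2 : (D γ : ℝ) ≤ (D γ : ℝ) ^ a := Real.self_le_rpow_of_one_le h1 ha
  nlinarith [mul_le_mul hM h2 (by linarith) (by linarith)]

/-- The spins of the contours of larger scale are constant near `γ`. -/
theorem contourSpin_eq_of_near (h : IsSeparatedFamily k K M a P s D)
    {γ γ' : Finset (Site d)} (hγ : γ ∈ P) (hγ' : γ' ∈ P) (hne : γ ≠ γ') (hD : D γ ≤ D γ')
    {p w : Site d} (hp : p ∈ γ) (hw : (l1dist p w : ℝ) ≤ M * (D γ : ℝ) ^ a) :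
    s γ' w = s γ' p := by
  by_contra hcon
  have := h.far γ hγ γ' hγ' hne p hp w hcon
  rw [min_eq_left hD] at this
  linarith

/-- `x` is within a quarter of the separation from some `p ∈ γ`, and `s γ'` keeps its value at `p`
up to the full separation. Three quarters remain; a half is enough. -/
theorem lt_l1dist_of_ne (h : IsSeparatedFamily k K M a P s D) (hk : 0 ≤ k) (hM : 4 * k ≤ M)
    (ha : 1 ≤ a) {γ γ' : Finset (Site d)} (hγ : γ ∈ P) (hγ' : γ' ∈ P) (hne : γ ≠ γ')
    (hD : D γ ≤ D γ') {x y : Site d} (hx : s γ x ≠ 1) (hxy : s γ' x ≠ s γ' y) :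
    M * (D γ : ℝ) ^ a / 2 < l1dist x y := by
  obtain ⟨p, hp, hxp⟩ := h.near γ hγ x hx
  have h1 := h.mul_scale_le hk hM ha hγ
  have h0 : 0 ≤ M * (D γ : ℝ) ^ a := mul_nonneg (by linarith) (by positivity)
  have h2 : s γ' x = s γ' p := h.contourSpin_eq_of_near hγ hγ' hne hD hp (by
    rw [l1dist_comm]; linarith)
  have h3 := h.far γ hγ γ' hγ' hne p hp y (by rw [← h2]; exact hxy.symm)
  rw [min_eq_left hD] at h3
  have h4 : (l1dist p y : ℝ) ≤ l1dist x p + l1dist x y := by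
    have := l1dist_triangle p x y
    rw [l1dist_comm p x] at this
    exact_mod_cast this
  linarith

/-- The interaction of a contour with those of larger scale is small. -/
theorem pairEnergy_larger_le (h : IsSeparatedFamily k K M a P s D) (hk : 0 ≤ k) (hM : 4 * k ≤ M)
    (hM0 : 0 < M) (ha : 1 ≤ a) (hJ : 0 ≤ J) (hβ : (d : ℝ) < α - d / a)
    {γ : Finset (Site d)} (hγ : γ ∈ P) :
    pairEnergy J α (fun x y => s γ x ≠ 1 ∧ ∃ γ' ∈ P, γ' ≠ γ ∧ D γ ≤ D γ' ∧ s γ' x ≠ s γ' y) ≤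
      ENNReal.ofReal (K * J * latticeSum d (α - d / a) * (M / 2) ^ (-(d / a))) := by
  have hD : (0 : ℝ) < D γ := by exact_mod_cast h.one_le γ hγ
  have hR : 0 < M * (D γ : ℝ) ^ a / 2 := by positivity
  have hda : 0 ≤ (d : ℝ) / a := by positivity
  refine (pairEnergy_le_card (h.finite γ hγ)
    (c := ENNReal.ofReal (J * (M * (D γ : ℝ) ^ a / 2) ^ ((α - d / a) - α) *
      latticeSum d (α - d / a))) (fun x y hxy => hxy.1) fun x hx => ?_).trans ?_
  · refine tsum_ecoupling_far_le hβ (by linarith) hJ hR x _ ?_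
    rintro y ⟨hx', γ', hγ', hne, hDD, hxy⟩
    exact (h.lt_l1dist_of_ne hk hM ha hγ hγ' hne.symm hDD hx' hxy).le
  · rw [← ENNReal.ofReal_natCast, ← ENNReal.ofReal_mul (Nat.cast_nonneg _)]
    refine ENNReal.ofReal_le_ofReal ?_
    have hS := latticeSum_nonneg d (α - d / a)
    refine (mul_le_mul_of_nonneg_right (h.ncard_le γ hγ) (by positivity)).trans (le_of_eq ?_)
    -- The exponent `α - d / a` was chosen so that the volume factor `D γ ^ d` cancels against `(D γ
    -- ^ a) ^ (-d / a)`.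
    rw [show M * (D γ : ℝ) ^ a / 2 = M / 2 * (D γ : ℝ) ^ a by ring,
      Real.mul_rpow (by positivity) (by positivity), ← Real.rpow_mul hD.le,
      show α - d / a - α = -(d / a) by ring,
      show a * -((d : ℝ) / a) = -d by field_simp]
    have : (D γ : ℝ) ^ (d : ℝ) * (D γ : ℝ) ^ (-d : ℝ) = 1 := by
      rw [← Real.rpow_add hD, add_neg_cancel, Real.rpow_zero]
    linear_combination (K * J * latticeSum d (α - d / a) * (M / 2) ^ (-(d / a))) * this

/-- At most one contour of each scale has its negative region close to a given site. -/
theorem eq_of_scale_eq (h : IsSeparatedFamily k K M a P s D) (hk : 0 ≤ k) (hM : 4 * k ≤ M)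
    (ha : 1 ≤ a) {γ γ' : Finset (Site d)} (hγ : γ ∈ P) (hγ' : γ' ∈ P) (hD : D γ = D γ')
    {u z z' : Site d} (hz : s γ z ≠ 1) (hz' : s γ' z' ≠ 1)
    (hu : (l1dist z u : ℝ) ≤ M * (D γ : ℝ) ^ a / 4)
    (hu' : (l1dist z' u : ℝ) ≤ M * (D γ' : ℝ) ^ a / 4) : γ = γ' := by
  by_contra hne
  obtain ⟨p, hp, hzp⟩ := h.near γ hγ z hz
  obtain ⟨p', hp', hzp'⟩ := h.near γ' hγ' z' hz'
  have h1 := h.separated γ hγ γ' hγ' hne p hp p' hp'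
  have h2 := h.mul_scale_le hk hM ha hγ
  rw [← hD] at hu' hzp'
  rw [← hD, min_self] at h1
  -- Four legs of at most a quarter of the separation each contradict the strict separation.
  have h3 : (l1dist p p' : ℝ) ≤ l1dist z p + l1dist z u + l1dist z' u + l1dist z' p' := by
    have t1 := l1dist_triangle p z p'
    have t2 := l1dist_triangle z u p'
    have t3 := l1dist_triangle u z' p'
    rw [l1dist_comm p z] at t1
    rw [l1dist_comm u z'] at t3
    exact_mod_cast (by omega : l1dist p p' ≤ l1dist z p + l1dist z u + l1dist z' u + l1dist z' p')
  linarith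

end IsSeparatedFamily

theorem tsum_indicator_le_ncard {X : Type*} {N : Set X} (hN : N.Finite) (p : X → Prop)
    {_ : DecidablePred p} (hp : ∀ x, p x → x ∈ N) (c : ℝ≥0∞) :
    ∑' x, (if p x then c else 0) ≤ N.ncard * c := by
  rw [tsum_eq_sum (s := hN.toFinset) fun x hx => if_neg fun h => hx (hN.mem_toFinset.2 (hp x h)),
    Set.ncard_eq_toFinset_card _ hN, ← nsmul_eq_mul]
  exact Finset.sum_le_card_nsmul _ _ _ fun x _ => by split_ifs <;> simp

namespace IsSeparatedFamily

variable {k K M a J α : ℝ} {P : Finset (Finset (Site d))} {s : Finset (Site d) → Config d}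
  {D : Finset (Site d) → ℕ}

/-- The interaction of a contour with those of smaller scale is small. -/
theorem pairEnergy_smaller_le (h : IsSeparatedFamily k K M a P s D) (hd : 0 < d) (hk : 0 ≤ k)
    (hM : 4 * k ≤ M) (hM0 : 0 < M) (hK : 0 ≤ K) (ha : (d : ℝ) + 1 < a) (hJ : 0 ≤ J) (hα : 0 < α)
    {γ : Finset (Site d)} (hγ : γ ∈ P) :
    pairEnergy J α (fun x y => (∃ γ' ∈ P, γ' ≠ γ ∧ D γ' < D γ ∧ s γ' x ≠ 1) ∧ s γ x ≠ s γ y) ≤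
      ENNReal.ofReal (4 * 2 ^ α * K / M * ∑' m : ℕ, (m : ℝ) ^ ((d : ℝ) - a)) *
        pairEnergy J α fun x y => s γ x ≠ s γ y := by
  classical
  have ha1 : 1 ≤ a := by have : (0 : ℝ) ≤ d := Nat.cast_nonneg d; linarith
  set i : Fin d := ⟨0, hd⟩
  set P' := P.filter fun γ' => γ' ≠ γ ∧ D γ' < D γ with hP'
  have hP'mem : ∀ γ' ∈ P', γ' ∈ P ∧ γ' ≠ γ ∧ D γ' < D γ := fun γ' h => Finset.mem_filter.1 h
  set ψ := siteEnergy J α (s γ) with hψ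
  -- The number of sites of the segment: its offsets `t < q γ'` stay within a quarter of the
  -- separation, while `q γ'` exceeds that quarter.
  set q : Finset (Site d) → ℕ := fun γ' => ⌊M * (D γ' : ℝ) ^ a / 4⌋₊ + 1 with hq
  have hL0 : ∀ γ', 0 ≤ M * (D γ' : ℝ) ^ a / 4 := fun γ' => by positivity
  have hqt : ∀ γ', ∀ t < q γ', (t : ℝ) ≤ M * (D γ' : ℝ) ^ a / 4 := fun γ' t ht =>
    (Nat.le_floor_iff (hL0 γ')).1 (Nat.lt_succ_iff.1 ht)
  have hqgt : ∀ γ', M * (D γ' : ℝ) ^ a / 4 < q γ' := fun γ' => by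
    rw [hq]; push_cast; exact Nat.lt_floor_add_one _
  -- The segment from a negative site of the smaller contour meets no change of `s γ`, so
  -- `siteEnergy_le_average` applies.
  have hpt : ∀ z, ∀ γ' ∈ P', (if s γ' z ≠ 1 then ψ z else 0) ≤
      ∑' u, if s γ' z ≠ 1 ∧ ∃ t < q γ', u = z + Pi.single i (t : ℤ) then
        ENNReal.ofReal (2 ^ α / q γ') * ψ u else 0 := by
    intro z γ' hγ'
    obtain ⟨hγ'P, hne, hDD⟩ := hP'mem γ' hγ'
    split_ifs with hz
    · simp only [hz, not_false_eq_true, true_and, ne_eq]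
      have hseg : ∀ t < q γ', s γ (z + Pi.single i (t : ℤ)) = s γ z := by
        intro t ht
        by_contra hcon
        have h1 := h.lt_l1dist_of_ne hk hM ha1 hγ'P hγ hne hDD.le hz (Ne.symm hcon)
        rw [l1dist_add_single, Int.natAbs_natCast] at h1
        have := hqt γ' t ht
        have := hL0 γ'
        linarith
      have hfar : ∀ w, s γ w ≠ s γ z → q γ' ≤ l1dist z w + 1 := by
        intro w hw
        have h1 := h.lt_l1dist_of_ne hk hM ha1 hγ'P hγ hne hDD.le hz (Ne.symm hw)
        refine Nat.succ_le_succ ?_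
        have h2 := hL0 γ'
        have h3 := (Nat.floor_le h2).trans (show _ ≤ (l1dist z w : ℝ) by linarith)
        exact_mod_cast h3
      refine (siteEnergy_le_average hJ hα i (Nat.succ_ne_zero _) hseg hfar).trans ?_
      refine (mul_le_mul_right (sum_segment_le_tsum ψ z i (q γ')) _).trans ?_
      rw [← ENNReal.tsum_mul_left]
      refine ENNReal.tsum_le_tsum fun u => ?_
      split_ifs
      · exact le_rfl
      · rw [mul_zero]
    · exact zero_le
  have hinj : ∀ u, ∀ γ₁ ∈ P', ∀ γ₂ ∈ P', D γ₁ = D γ₂ →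
      (∃ z, s γ₁ z ≠ 1 ∧ ∃ t < q γ₁, u = z + Pi.single i (t : ℤ)) →
      (∃ z, s γ₂ z ≠ 1 ∧ ∃ t < q γ₂, u = z + Pi.single i (t : ℤ)) → γ₁ = γ₂ := by
    rintro u γ₁ hγ₁ γ₂ hγ₂ hD ⟨z₁, hz₁, t₁, ht₁, hu₁⟩ ⟨z₂, hz₂, t₂, ht₂, hu₂⟩
    refine h.eq_of_scale_eq hk hM ha1 (hP'mem γ₁ hγ₁).1 (hP'mem γ₂ hγ₂).1 hD hz₁ hz₂ (u := u) ?_ ?_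
    · rw [hu₁, l1dist_add_single, Int.natAbs_natCast]
      exact hqt γ₁ t₁ ht₁
    · rw [hu₂, l1dist_add_single, Int.natAbs_natCast]
      exact hqt γ₂ t₂ ht₂
  set A : ℝ := 4 * 2 ^ α * K / M with hA
  have hA0 : 0 ≤ A := by positivity
  have hsummable : Summable fun m : ℕ => A * (m : ℝ) ^ ((d : ℝ) - a) :=
    (Real.summable_nat_rpow.2 (by linarith)).mul_left A
  -- The total weight charged to `u`: a contour of scale `m` has at most `K * m ^ d` starting sites,
  -- each of weight at most `2 ^ α / (M * m ^ a / 4)`.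
  have hcoef : ∀ u, ∑ γ' ∈ P', ∑' z, (if s γ' z ≠ 1 ∧ ∃ t < q γ', u = z + Pi.single i (t : ℤ) then
      ENNReal.ofReal (2 ^ α / q γ') * ψ u else 0) ≤
      ENNReal.ofReal (A * ∑' m : ℕ, (m : ℝ) ^ ((d : ℝ) - a)) * ψ u := by
    intro u
    set Q := P'.filter fun γ' => ∃ z, s γ' z ≠ 1 ∧ ∃ t < q γ', u = z + Pi.single i (t : ℤ) with hQ
    have hterm : ∀ γ' ∈ P', ∑' z, (if s γ' z ≠ 1 ∧ ∃ t < q γ', u = z + Pi.single i (t : ℤ) then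
        ENNReal.ofReal (2 ^ α / q γ') * ψ u else 0) ≤
        if (∃ z, s γ' z ≠ 1 ∧ ∃ t < q γ', u = z + Pi.single i (t : ℤ)) then
          ENNReal.ofReal (A * (D γ' : ℝ) ^ ((d : ℝ) - a)) * ψ u else 0 := by
      intro γ' hγ'
      have hγ'P := (hP'mem γ' hγ').1
      have hD0 : (0 : ℝ) < D γ' := by exact_mod_cast h.one_le γ' hγ'P
      split_ifs with hex
      · refine (tsum_indicator_le_ncard (h.finite γ' hγ'P) _ (fun z hz => hz.1) _).trans ?_
        rw [← mul_assoc, ← ENNReal.ofReal_natCast, ← ENNReal.ofReal_mul (Nat.cast_nonneg _)]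
        refine mul_le_mul_left (ENNReal.ofReal_le_ofReal ?_) _
        have hLpos : 0 < M * (D γ' : ℝ) ^ a / 4 := by positivity
        calc ({x | s γ' x ≠ 1}.ncard : ℝ) * (2 ^ α / q γ')
            ≤ (K * (D γ' : ℝ) ^ (d : ℝ)) * (2 ^ α / (M * (D γ' : ℝ) ^ a / 4)) := by
              have := h.ncard_le γ' hγ'P
              have := (hqgt γ').le
              gcongr
          _ = A * (D γ' : ℝ) ^ ((d : ℝ) - a) := by
              rw [Real.rpow_sub hD0, hA]
              field_simp
      · push Not at hex
        rw [ENNReal.tsum_eq_zero.2 fun z => if_neg ?_]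
        rintro ⟨hz, t, ht, hu⟩
        exact hex z hz t ht hu
    refine (Finset.sum_le_sum hterm).trans ?_
    rw [← Finset.sum_filter, ← Finset.sum_mul]
    refine mul_le_mul_left ?_ _
    rw [← tsum_mul_left, ENNReal.ofReal_tsum_of_nonneg (fun m => by positivity) hsummable]
    -- Contours reaching `u` have distinct scales, so the sum over them is part of the series over
    -- `m`.
    have himage : ∑ γ' ∈ Q, ENNReal.ofReal (A * (D γ' : ℝ) ^ ((d : ℝ) - a)) =
        ∑ m ∈ Q.image D, ENNReal.ofReal (A * (m : ℝ) ^ ((d : ℝ) - a)) := by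
      rw [Finset.sum_image]
      intro γ₁ h₁ γ₂ h₂ hD
      obtain ⟨h₁, h₁'⟩ := Finset.mem_filter.1 (Finset.mem_coe.1 h₁)
      obtain ⟨h₂, h₂'⟩ := Finset.mem_filter.1 (Finset.mem_coe.1 h₂)
      exact hinj u γ₁ h₁ γ₂ h₂ hD h₁' h₂'
    rw [himage]
    exact ENNReal.sum_le_tsum _
  calc pairEnergy J α (fun x y => (∃ γ' ∈ P, γ' ≠ γ ∧ D γ' < D γ ∧ s γ' x ≠ 1) ∧ s γ x ≠ s γ y)
      ≤ ∑' z, ∑ γ' ∈ P', if s γ' z ≠ 1 then ψ z else 0 := by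
        refine ENNReal.tsum_le_tsum fun z => ?_
        by_cases hz : ∃ γ' ∈ P, γ' ≠ γ ∧ D γ' < D γ ∧ s γ' z ≠ 1
        · obtain ⟨γ', hγ', hne, hDD, hz'⟩ := hz
          refine le_trans ?_ (Finset.single_le_sum (fun _ _ => zero_le)
            (Finset.mem_filter.2 ⟨hγ', hne, hDD⟩))
          rw [if_pos hz']
          refine ENNReal.tsum_le_tsum fun w => ?_
          by_cases hw : s γ z = s γ w
          · simp [hw]
          · simp only [ne_eq, hw, not_false_eq_true, if_true]
            split_ifs <;> simp
        · simp [hz]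
    _ ≤ ∑' z, ∑ γ' ∈ P', ∑' u, if s γ' z ≠ 1 ∧ ∃ t < q γ', u = z + Pi.single i (t : ℤ) then
          ENNReal.ofReal (2 ^ α / q γ') * ψ u else 0 :=
        ENNReal.tsum_le_tsum fun z => Finset.sum_le_sum (hpt z)
    _ = ∑' u, ∑ γ' ∈ P', ∑' z, if s γ' z ≠ 1 ∧ ∃ t < q γ', u = z + Pi.single i (t : ℤ) then
          ENNReal.ofReal (2 ^ α / q γ') * ψ u else 0 := by
        rw [Summable.tsum_finsetSum fun _ _ => ENNReal.summable,
          Summable.tsum_finsetSum fun _ _ => ENNReal.summable]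
        exact Finset.sum_congr rfl fun γ' _ => ENNReal.tsum_comm
    _ ≤ ∑' u, ENNReal.ofReal (A * ∑' m : ℕ, (m : ℝ) ^ ((d : ℝ) - a)) * ψ u :=
        ENNReal.tsum_le_tsum hcoef
    _ = _ := by rw [ENNReal.tsum_mul_left, hψ, tsum_siteEnergy]

/-- The constant in the bound on the interaction between different contours. -/
noncomputable def interactionBound (d : ℕ) (K α a M : ℝ) : ℝ :=
  K * latticeSum d (α - d / a) * (M / 2) ^ (-(d / a)) +
    4 * (4 * 2 ^ α * K / M * ∑' m : ℕ, (m : ℝ) ^ ((d : ℝ) - a))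

theorem tendsto_interactionBound (d : ℕ) (hd : 0 < d) (K α a : ℝ) (ha : 0 < a) :
    Filter.Tendsto (interactionBound d K α a) Filter.atTop (nhds 0) := by
  have h1 : Filter.Tendsto (fun M : ℝ => (M / 2) ^ (-((d : ℝ) / a))) Filter.atTop (nhds 0) :=
    (tendsto_rpow_neg_atTop (by positivity)).comp (Filter.tendsto_id.atTop_div_const (by norm_num))
  have h2 : Filter.Tendsto (fun M : ℝ => 4 * 2 ^ α * K / M) Filter.atTop (nhds 0) :=
    Filter.Tendsto.const_div_atTop Filter.tendsto_id _
  have := (h1.const_mul (K * latticeSum d (α - d / a))).add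
    ((h2.mul_const (∑' m : ℕ, (m : ℝ) ^ ((d : ℝ) - a))).const_mul 4)
  simp only [mul_zero, zero_mul, add_zero] at this
  exact this

/-- The energy of the pairs on which the spin of `γ` and that of some other contour change is small
compared with the energy of the pairs on which the spin of `γ` changes. -/
theorem pairEnergy_interaction_le (h : IsSeparatedFamily k K M a P s D) (hd : 0 < d) (hk : 0 ≤ k)
    (hM : 4 * k ≤ M) (hM0 : 0 < M) (hK : 0 ≤ K) (ha : (d : ℝ) + 1 < a) (hJ : 0 < J)
    (hβ : (d : ℝ) < α - d / a) {γ : Finset (Site d)} (hγ : γ ∈ P) (hne : ∃ x, s γ x ≠ 1) :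
    pairEnergy J α (fun x y => (s γ x ≠ 1 ∧ s γ y = 1) ∧ ∃ γ' ∈ P, γ' ≠ γ ∧ s γ' x ≠ s γ' y) ≤
      ENNReal.ofReal (interactionBound d K α a M) *
        pairEnergy J α fun x y => s γ x ≠ 1 ∧ s γ y = 1 := by
  have hd0 : (0 : ℝ) ≤ d := Nat.cast_nonneg d
  have ha0 : 0 < a := by linarith
  have hα : 0 < α := by
    have : 0 ≤ (d : ℝ) / a := by positivity
    linarith
  set S := ∑' m : ℕ, (m : ℝ) ^ ((d : ℝ) - a)
  have hS : 0 ≤ S := tsum_nonneg fun m => by positivity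
  set T := K * latticeSum d (α - d / a) * (M / 2) ^ (-(d / a)) with hT
  have hT0 : 0 ≤ T := by have := latticeSum_nonneg d (α - d / a); positivity
  have hA0 : 0 ≤ 4 * 2 ^ α * K / M * S := by positivity
  set F := pairEnergy J α fun x y => s γ x ≠ 1 ∧ s γ y = 1 with hF
  -- One nearest-neighbour edge leaving the negative region carries energy `J`; this turns the
  -- absolute bound for larger contours into a relative one.
  have hJF : ENNReal.ofReal J ≤ F := by
    have : Nonempty (Fin d) := ⟨⟨0, hd⟩⟩
    obtain ⟨x, hx, y, hy, hxy⟩ := exists_boundary_edge (A := {x | s γ x ≠ 1}) hne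
      (fun e => Set.infinite_univ (e ▸ h.finite γ hγ))
    exact ofReal_le_pairEnergy hxy ⟨hx, not_not.1 hy⟩
  have hlarge := h.pairEnergy_larger_le hk hM hM0 (by linarith) hJ.le hβ hγ
  have hsmall := h.pairEnergy_smaller_le hd hk hM hM0 hK ha hJ.le hα hγ
  set R₂ : Site d → Site d → Prop := fun x y =>
    (∃ γ' ∈ P, γ' ≠ γ ∧ D γ' < D γ ∧ s γ' x ≠ 1) ∧ s γ x ≠ s γ y with hR₂
  have hsmall' : pairEnergy J α R₂ ≤ ENNReal.ofReal (4 * 2 ^ α * K / M * S) * (2 * F) :=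
    hsmall.trans (by gcongr; exact pairEnergy_ne_le (s γ))
  have hlarge' : ENNReal.ofReal (K * J * latticeSum d (α - d / a) * (M / 2) ^ (-(d / a))) ≤
      ENNReal.ofReal T * F := by
    refine le_trans (le_of_eq ?_) (mul_le_mul_right hJF _)
    rw [← ENNReal.ofReal_mul hT0, hT]
    congr 1
    ring
  -- If a smaller contour's spin changes on the pair, it is negative at one end, hence the two
  -- orientations of `R₂`. With the `2` from `pairEnergy_ne_le` they give the factor `4` in
  -- `interactionBound`.
  calc _ ≤ pairEnergy J α (fun x y =>
          (s γ x ≠ 1 ∧ ∃ γ' ∈ P, γ' ≠ γ ∧ D γ ≤ D γ' ∧ s γ' x ≠ s γ' y) ∨ (R₂ x y ∨ R₂ y x)) := by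
        refine pairEnergy_mono ?_
        rintro x y ⟨⟨hx, hy⟩, γ', hγ', hne', hxy⟩
        rcases le_or_gt (D γ) (D γ') with hDD | hDD
        · exact Or.inl ⟨hx, γ', hγ', hne', hDD, hxy⟩
        · have hxy' : s γ x ≠ s γ y := by rwa [hy]
          by_cases hx1 : s γ' x = 1
          · exact Or.inr (Or.inr ⟨⟨γ', hγ', hne', hDD, fun e => hxy (hx1.trans e.symm)⟩,
              hxy'.symm⟩)
          · exact Or.inr (Or.inl ⟨⟨γ', hγ', hne', hDD, hx1⟩, hxy'⟩)
    _ ≤ _ := (pairEnergy_or_le _ _).trans (add_le_add_right (pairEnergy_or_le _ _) _)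
    _ ≤ ENNReal.ofReal T * F + (ENNReal.ofReal (4 * 2 ^ α * K / M * S) * (2 * F) +
          ENNReal.ofReal (4 * 2 ^ α * K / M * S) * (2 * F)) := by
        refine add_le_add (hlarge.trans hlarge') (add_le_add hsmall' ?_)
        rw [pairEnergy_swap]
        exact hsmall'
    _ = _ := by
        rw [interactionBound, ENNReal.ofReal_add hT0 (by positivity),
          ENNReal.ofReal_mul (by norm_num : (0 : ℝ) ≤ 4), ENNReal.ofReal_ofNat]
        ring

end IsSeparatedFamily

/-- The scale is the largest piece diameter, cut off at `1`. With at most `n` pieces the reach is at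
most `n * (D + 1) ≤ 2 * n * D`, and the ball side in `ncard_le` is at most `2 * (D + 2 * n * D) + 1
≤ (4 * n + 3) * D`. For `far`, a ball around `p` that misses `γ'` carries no change of `s γ'`. -/
theorem IsContourPartition.exists_isSeparatedFamily {M a r : ℝ} {σ : Config d}
    {P : Finset (Finset (Site d))} {s : Finset (Site d) → Config d} {n : ℕ}
    (hP : IsContourPartition M a r σ P) (hd : 2 ≤ d) (hn : (2 : ℝ) ^ r - 1 ≤ n)
    (hs : ∀ γ ∈ P, IsContourSpin σ γ (s γ)) :
    ∃ D, IsSeparatedFamily (2 * n) (n * (4 * n + 3) ^ d) M a P s D := by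
  obtain ⟨pieces, hpieces, hsep⟩ := hP.separated
  have hcard : ∀ γ ∈ P, (pieces γ).card ≤ n := fun γ hγ => by
    exact_mod_cast (hpieces γ hγ).2.1.trans hn
  have hsep' : ∀ γ ∈ P, ∀ γ' ∈ P, γ ≠ γ' → ∀ p ∈ γ, ∀ q ∈ γ',
      M * ((min (max 1 (maxDiam (pieces γ))) (max 1 (maxDiam (pieces γ'))) : ℕ) : ℝ) ^ a <
        l1dist p q := fun γ hγ γ' hγ' hne p hp q hq => by
    rw [← max_min_distrib_left]
    exact hsep γ hγ γ' hγ' hne p hp q hq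
  refine ⟨fun γ => max 1 (maxDiam (pieces γ)), fun γ _ => le_max_left _ _,
    fun γ hγ => (hs γ hγ).finite, fun γ hγ => ?_, fun γ hγ x hx => ?_, hsep',
    fun γ hγ γ' hγ' hne p hp w hw => ?_⟩
  · have h1 : 1 ≤ max 1 (maxDiam (pieces γ)) := le_max_left _ _
    have h2 : maxDiam (pieces γ) ≤ max 1 (maxDiam (pieces γ)) := le_max_right _ _
    have h := (hs γ hγ).ncard_le hd (hpieces γ hγ).2.2
    generalize max 1 (maxDiam (pieces γ)) = D at h1 h2 ⊢
    rw [Real.rpow_natCast, mul_assoc, ← mul_pow]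
    have h3 : (pieces γ).card * (maxDiam (pieces γ) + 1) ≤ n * (2 * D) :=
      Nat.mul_le_mul (hcard γ hγ) (by omega)
    have h4 : 2 * (maxDiam (pieces γ) + (pieces γ).card * (maxDiam (pieces γ) + 1)) + 1 ≤
        (4 * n + 3) * D := by nlinarith
    exact_mod_cast h.trans (Nat.mul_le_mul (hcard γ hγ) (Nat.pow_le_pow_left h4 d))
  · obtain ⟨p, hp, hxp⟩ := (hs γ hγ).exists_l1dist_le hd (hpieces γ hγ).2.2 hx
    refine ⟨p, hp, ?_⟩
    have h1 : 1 ≤ max 1 (maxDiam (pieces γ)) := le_max_left _ _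
    have h2 : maxDiam (pieces γ) ≤ max 1 (maxDiam (pieces γ)) := le_max_right _ _
    have h3 : (pieces γ).card * (maxDiam (pieces γ) + 1) ≤
        n * (2 * max 1 (maxDiam (pieces γ))) := Nat.mul_le_mul (hcard γ hγ) (by omega)
    have h4 : l1dist x p ≤ 2 * n * max 1 (maxDiam (pieces γ)) := by
      rw [mul_comm 2 n, mul_assoc]
      exact hxp.trans h3
    exact_mod_cast h4
  · by_contra hcon
    refine hw (eq_of_l1dist (hs γ' hγ').eq_of_adj_of_notMem p w fun z hz hzγ => hcon ?_).symm
    refine (hsep' γ hγ γ' hγ' hne p hp z hzγ).trans_le ?_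
    exact_mod_cast hz

/-! ### Energy difference of a flip -/

section hamiltonian

variable {J α : ℝ}

theorem summable_coupling (hα : (d : ℝ) < α) (hJ : 0 ≤ J) (x : Site d) :
    Summable (coupling J α x) := by
  have h : ∑' y, ecoupling J α x y ≠ ∞ := by rw [tsum_ecoupling hα hJ]; finiteness
  simpa only [toReal_ecoupling hJ] using ENNReal.summable_toReal h

theorem abs_spin (σ : Config d) (x : Site d) : |spin σ x| = 1 := by
  unfold spin
  rcases Int.units_eq_one_or (σ x) with h | h <;> simp [h]

theorem summable_coupling_mul (hα : (d : ℝ) < α) (hJ : 0 ≤ J) (x : Site d) {g : Site d → ℝ} {c : ℝ}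
    (hg : ∀ y, |g y| ≤ c) : Summable fun y => coupling J α x y * g y := by
  refine Summable.of_norm_bounded ((summable_coupling hα hJ x).mul_right c) fun y => ?_
  rw [Real.norm_eq_abs, abs_mul, abs_of_nonneg (coupling_nonneg hJ α x y)]
  exact mul_le_mul_of_nonneg_left (hg y) (coupling_nonneg hJ α x y)

theorem summable_coupling_spin (hα : (d : ℝ) < α) (hJ : 0 ≤ J) (σ : Config d) (x : Site d) :
    Summable fun y => coupling J α x y * spin σ x * spin σ y := by
  simp only [mul_assoc]
  exact summable_coupling_mul hα hJ x (c := 1) fun y => by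
    rw [abs_mul, abs_spin, abs_spin, one_mul]

theorem hamiltonian_plus_eq (hα : (d : ℝ) < α) (hJ : 0 ≤ J) {Λ : Finset (Site d)} {σ : Config d}
    (hσ : σ ∈ configsWithBC Λ (plus d)) :
    hamiltonian J α Λ (plus d) σ =
      - ∑ x ∈ Λ, ∑' y, coupling J α x y * spin σ x * spin σ y := by
  unfold hamiltonian
  rw [← neg_add', ← Finset.sum_add_distrib]
  congr 1
  refine Finset.sum_congr rfl fun x _ => ?_
  rw [← (summable_coupling_spin hα hJ σ x).sum_add_tsum_subtype_compl Λ]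
  congr 1
  refine tsum_congr fun y => ?_
  rw [spin, spin, spin, hσ y y.2]

theorem sum_tsum_coupling_eq (hJ : 0 ≤ J) (hα : (d : ℝ) < α) (Λ : Finset (Site d))
    (R : Site d → Site d → Prop) [∀ x y, Decidable (R x y)] :
    ∑ x ∈ Λ, ∑' y, coupling J α x y * (if R x y then 1 else 0) =
      (pairEnergy J α fun x y => x ∈ Λ ∧ R x y).toReal := by
  have hle : ∀ x, ∑' y, (if R x y then ecoupling J α x y else 0) ≠ ∞ := fun x => by
    refine ne_top_of_le_ne_top (b := ENNReal.ofReal (J * latticeSum d α)) (by finiteness) ?_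
    rw [← tsum_ecoupling hα hJ x]
    exact ENNReal.tsum_le_tsum fun y => by split_ifs <;> simp
  unfold pairEnergy
  rw [tsum_eq_sum (s := Λ) fun x hx => by simp [hx], ENNReal.toReal_sum]
  · refine Finset.sum_congr rfl fun x hx => ?_
    simp only [hx, true_and]
    rw [ENNReal.tsum_toReal_eq fun y => by split_ifs <;> simp [ecoupling_ne_top]]
    refine tsum_congr fun y => ?_
    split_ifs <;> simp [toReal_ecoupling hJ]
  · intro x hx
    simpa only [hx, true_and] using hle x

/-- A pair contributes `-τ x * τ y * (1 - θ x * θ y)` times its coupling: nothing if `θ` agrees,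
otherwise `-2`, plus `4` if `τ` differs. -/
theorem hamiltonian_mul_sub_le (hα : (d : ℝ) < α) (hJ : 0 ≤ J) {Λ : Finset (Site d)}
    {σ θ τ : Config d} (hσ : σ ∈ configsWithBC Λ (plus d)) (hθ : ∀ x, x ∉ Λ → θ x = 1)
    (hτ : ∀ x, τ x = σ x * θ x) :
    hamiltonian J α Λ (plus d) τ - hamiltonian J α Λ (plus d) σ ≤
      -2 * (pairEnergy J α fun x y => θ x ≠ 1 ∧ θ y = 1).toReal +
        8 * (pairEnergy J α fun x y => (θ x ≠ 1 ∧ θ y = 1) ∧ τ x ≠ τ y).toReal := by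
  classical
  have hτΛ : τ ∈ configsWithBC Λ (plus d) := fun x hx => by rw [hτ, hθ x hx, mul_one, hσ x hx]
  have hθΛ : ∀ x, θ x ≠ 1 → x ∈ Λ := fun x h => by
    by_contra hx
    exact h (hθ x hx)
  rw [hamiltonian_plus_eq hα hJ hτΛ, hamiltonian_plus_eq hα hJ hσ]
  have hind : ∀ (R : Site d → Site d → Prop) [∀ x y, Decidable (R x y)] x,
      Summable fun y => coupling J α x y * (if R x y then (1 : ℝ) else 0) := fun R _ x =>
    summable_coupling_mul hα hJ x (c := 1) fun y => by split_ifs <;> simp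
  have hsite : ∀ x, -∑' y, coupling J α x y * spin τ x * spin τ y +
      ∑' y, coupling J α x y * spin σ x * spin σ y ≤
      -2 * ∑' y, coupling J α x y * (if θ x ≠ θ y then (1 : ℝ) else 0) +
        4 * ∑' y, coupling J α x y * (if θ x ≠ θ y ∧ τ x ≠ τ y then (1 : ℝ) else 0) := by
    intro x
    have hs1 := summable_coupling_spin hα hJ σ x
    have hs2 := summable_coupling_spin hα hJ τ x
    have hs3 := hind (fun x y => θ x ≠ θ y) x
    have hs4 := hind (fun x y => θ x ≠ θ y ∧ τ x ≠ τ y) x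
    rw [← tsum_neg, ← hs2.neg.tsum_add hs1, ← tsum_mul_left, ← tsum_mul_left,
      ← (hs3.mul_left (-2)).tsum_add (hs4.mul_left 4)]
    refine (hs2.neg.add hs1).tsum_le_tsum (fun y => ?_) ((hs3.mul_left (-2)).add (hs4.mul_left 4))
    have hc := coupling_nonneg hJ α x y
    have hστ : ∀ x, spin σ x = spin τ x * spin θ x := fun x => by
      have : σ x = τ x * θ x := by rw [hτ, mul_assoc, Int.units_mul_self, mul_one]
      simp [spin, this]
    rw [hστ x, hστ y]
    rcases Int.units_eq_one_or (θ x) with h1 | h1 <;>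
      rcases Int.units_eq_one_or (θ y) with h2 | h2 <;>
      rcases Int.units_eq_one_or (τ x) with h3 | h3 <;>
      rcases Int.units_eq_one_or (τ y) with h4 | h4 <;>
      simp [spin, h1, h2, h3, h4] <;> linarith
  have hsum := Finset.sum_le_sum fun x (_ : x ∈ Λ) => hsite x
  rw [Finset.sum_add_distrib, Finset.sum_add_distrib, Finset.sum_neg_distrib, ← Finset.mul_sum,
    ← Finset.mul_sum, sum_tsum_coupling_eq hJ hα Λ fun x y => θ x ≠ θ y,
    sum_tsum_coupling_eq hJ hα Λ fun x y => θ x ≠ θ y ∧ τ x ≠ τ y] at hsum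
  have hfin : ∀ R : Site d → Site d → Prop, (∀ x y, R x y → x ∈ Λ) → pairEnergy J α R ≠ ∞ :=
    fun R hR => pairEnergy_ne_top hα hJ Λ.finite_toSet hR
  -- Pairs negative at the second end are dropped: their first end may lie outside `Λ`, where it is
  -- not summed. In the error term both orders are kept, so `4` becomes `8`.
  have h1 : (pairEnergy J α fun x y => θ x ≠ 1 ∧ θ y = 1).toReal ≤
      (pairEnergy J α fun x y => x ∈ Λ ∧ θ x ≠ θ y).toReal := by
    refine ENNReal.toReal_mono (hfin _ fun x y h => h.1) (pairEnergy_mono fun x y h => ?_)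
    exact ⟨hθΛ x h.1, by rw [h.2]; exact h.1⟩
  have h2 : (pairEnergy J α fun x y => x ∈ Λ ∧ θ x ≠ θ y ∧ τ x ≠ τ y).toReal ≤
      2 * (pairEnergy J α fun x y => (θ x ≠ 1 ∧ θ y = 1) ∧ τ x ≠ τ y).toReal := by
    have hE := hfin (fun x y => (θ x ≠ 1 ∧ θ y = 1) ∧ τ x ≠ τ y) fun x y h => hθΛ x h.1.1
    rw [two_mul, ← ENNReal.toReal_add hE hE]
    refine ENNReal.toReal_mono (by finiteness) ?_
    conv_rhs => arg 2; rw [← pairEnergy_swap]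
    refine (pairEnergy_mono fun x y h => ?_).trans (pairEnergy_or_le _ _)
    obtain ⟨-, hθxy, hτxy⟩ := h
    by_cases hx : θ x = 1
    · exact Or.inr ⟨⟨fun hy => hθxy (hx.trans hy.symm), hx⟩, hτxy.symm⟩
    · refine Or.inl ⟨⟨hx, ?_⟩, hτxy⟩
      by_contra hy
      exact hθxy (((Int.units_eq_one_or _).resolve_left hx).trans
        ((Int.units_eq_one_or _).resolve_left hy).symm)
  linarith

end hamiltonian

theorem sum_pairEnergy_le {J α : ℝ} {ι : Type*} (P : Finset ι) {R : ι → Site d → Site d → Prop}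
    {R' : Site d → Site d → Prop} (hR : ∀ i ∈ P, ∀ x y, R i x y → R' x y)
    (hdisj : ∀ i ∈ P, ∀ j ∈ P, ∀ x y, R i x y → R j x y → i = j) :
    ∑ i ∈ P, pairEnergy J α (R i) ≤ pairEnergy J α R' := by
  classical
  unfold pairEnergy
  rw [← Summable.tsum_finsetSum fun _ _ => ENNReal.summable]
  refine ENNReal.tsum_le_tsum fun x => ?_
  rw [← Summable.tsum_finsetSum fun _ _ => ENNReal.summable]
  refine ENNReal.tsum_le_tsum fun y => ?_
  by_cases h : ∃ i ∈ P, R i x y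
  · obtain ⟨i, hi, hxy⟩ := h
    rw [Finset.sum_eq_single_of_mem i hi fun j hj hne =>
      if_neg fun hj' => hne (hdisj j hj i hi x y hj' hxy), if_pos hxy, if_pos (hR i hi x y hxy)]
  · rw [Finset.sum_eq_zero fun i hi => if_neg fun hxy => h ⟨i, hi, hxy⟩]
    exact zero_le

/-! ### Energy of a single contour -/

section contour

variable {J α M a r : ℝ} {σ : Config d} {P : Finset (Finset (Site d))}
  {s : Finset (Site d) → Config d}

/-- The number of sites of a contour is controlled by the energy of its spin. -/
theorem IsContourPartition.card_le_pairEnergy (hP : IsContourPartition M a r σ P)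
    (hs : ∀ γ ∈ P, IsContourSpin σ γ (s γ)) (hα : (d : ℝ) < α) (hJ : 0 ≤ J)
    {γ : Finset (Site d)} (hγ : γ ∈ P) :
    J * γ.card ≤ 2 * (pairEnergy J α fun x y => s γ x ≠ 1 ∧ s γ y = 1).toReal := by
  classical
  have h1 : γ.card * ENNReal.ofReal J ≤ pairEnergy J α fun x y => s γ x ≠ s γ y := by
    rw [← nsmul_eq_mul]
    refine le_trans ?_ (ENNReal.sum_le_tsum γ)
    refine Finset.card_nsmul_le_sum _ _ _ fun x hx => ?_
    obtain ⟨y, hxy, hne⟩ := hP.exists_adj_contourSpin_ne hs hγ hx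
    refine le_trans ?_ (ENNReal.le_tsum y)
    rw [if_pos hne, ecoupling, coupling_of_adj J α hxy]
  have hfin : (pairEnergy J α fun x y => s γ x ≠ 1 ∧ s γ y = 1) ≠ ∞ :=
    pairEnergy_ne_top hα hJ (hs γ hγ).finite fun x y h => h.1
  have h2 := ENNReal.toReal_mono (by finiteness) (h1.trans (pairEnergy_ne_le (s γ)))
  simp only [ENNReal.toReal_mul, ENNReal.toReal_natCast, ENNReal.toReal_ofReal hJ,
    ENNReal.toReal_ofNat] at h2
  linarith

theorem surfaceEnergy_le_card (hα : (d : ℝ) < α) (hJ : 0 ≤ J) (A : Finset (Site d)) :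
    surfaceEnergy J α (A : Set (Site d)) ≤ J * latticeSum d α * A.card := by
  have hS := latticeSum_nonneg d α
  rw [surfaceEnergy_eq hα hJ]
  have h := pairEnergy_le_card_mul (R := fun x y => x ∈ (A : Set (Site d)) ∧ y ∉ (A : Set (Site d)))
    hα hJ A.finite_toSet fun x y h => h.1
  refine (ENNReal.toReal_mono (by finiteness) h).trans (le_of_eq ?_)
  rw [ENNReal.toReal_mul, ENNReal.toReal_natCast, ENNReal.toReal_ofReal (by positivity),
    Set.ncard_coe_finset, mul_comm]

/-- Removing a finite set from the negative region of a spin changes the surface energy by at most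
a multiple of the number of removed points. -/
theorem surfaceEnergy_sdiff_le (hα : (d : ℝ) < α) (hJ : 0 ≤ J) {t : Config d}
    (ht : {x | t x ≠ 1}.Finite) (A : Finset (Site d)) {I : Set (Site d)}
    (hI : ∀ x, x ∈ I ↔ x ∉ A ∧ t x ≠ 1) :
    surfaceEnergy J α I ≤ (pairEnergy J α fun x y => t x ≠ 1 ∧ t y = 1).toReal +
      J * latticeSum d α * A.card := by
  have hS := latticeSum_nonneg d α
  have hfin : (pairEnergy J α fun x y => t x ≠ 1 ∧ t y = 1) ≠ ∞ :=
    pairEnergy_ne_top hα hJ ht fun x y h => h.1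
  rw [surfaceEnergy_eq hα hJ]
  have h1 : pairEnergy J α (fun x y => x ∈ I ∧ y ∉ I) ≤
      (pairEnergy J α fun x y => t x ≠ 1 ∧ t y = 1) +
        (A : Set (Site d)).ncard * ENNReal.ofReal (J * latticeSum d α) := by
    -- A pair leaving `I` either leaves the negative region or ends in `A`.
    refine (pairEnergy_mono (R₂ := fun x y => (t x ≠ 1 ∧ t y = 1) ∨ y ∈ (A : Set (Site d)))
      fun x y ⟨hx, hy⟩ => ?_).trans ((pairEnergy_or_le _ _).trans (add_le_add_right ?_ _))
    · rw [← pairEnergy_swap]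
      exact pairEnergy_le_card_mul hα hJ A.finite_toSet fun x y h => h
    · by_cases hyA : y ∈ A
      · exact Or.inr hyA
      · refine Or.inl ⟨((hI x).1 hx).2, ?_⟩
        by_contra h
        exact hy ((hI y).2 ⟨hyA, h⟩)
  refine (ENNReal.toReal_mono (by finiteness) h1).trans (le_of_eq ?_)
  rw [ENNReal.toReal_add hfin (by finiteness), ENNReal.toReal_mul, ENNReal.toReal_natCast,
    ENNReal.toReal_ofReal (by positivity), Set.ncard_coe_finset, mul_comm (A.card : ℝ)]

end contour

/-! ### Energy of a family of external contours -/

/-- If different contours interact weakly, then removing a family of external contours lowers the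
energy by at least the sum of the energies of their spins. -/
theorem IsExternalFamily.hamiltonian_contourFlip_sub_le {J α M a r : ℝ} {σ : Config d}
    {Λ : Finset (Site d)} {P Γ : Finset (Finset (Site d))} {s : Finset (Site d) → Config d}
    (hΓ : IsExternalFamily Λ σ P Γ 1) (hP : IsContourPartition M a r σ P) (hd : 0 < d)
    (hs : ∀ γ ∈ P, IsContourSpin σ γ (s γ)) (hα : (d : ℝ) < α) (hJ : 0 ≤ J)
    (hσ : σ ∈ configsWithBC Λ (plus d))
    (hweak : ∀ γ ∈ P, pairEnergy J α (fun x y => (s γ x ≠ 1 ∧ s γ y = 1) ∧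
      ∃ γ' ∈ P, γ' ≠ γ ∧ s γ' x ≠ s γ' y) ≤
        ENNReal.ofReal (1 / 10) * pairEnergy J α fun x y => s γ x ≠ 1 ∧ s γ y = 1) :
    hamiltonian J α Λ (plus d) (contourFlip Γ σ) - hamiltonian J α Λ (plus d) σ ≤
      - ∑ γ ∈ Γ, (pairEnergy J α fun x y => s γ x ≠ 1 ∧ s γ y = 1).toReal := by
  have hσfin : {x | σ x ≠ 1}.Finite := Λ.finite_toSet.subset fun x hx => by
    by_contra h
    exact hx (hσ x h)
  set θ : Config d := fun x => ∏ γ ∈ Γ, s γ x with hθdef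
  have hflip : ∀ x, contourFlip Γ σ x = σ x * θ x := hΓ.contourFlip_eq_mul hP hs hd hσfin
  have hθeq : ∀ γ ∈ Γ, ∀ x, s γ x ≠ 1 → θ x = s γ x := fun γ hγ x hx =>
    Finset.prod_eq_single_of_mem γ hγ fun γ' hγ' hne =>
      hΓ.contourSpin_eq_one_of_ne_one hP hs hd hγ hγ' hne hx
  have hθex : ∀ x, θ x ≠ 1 → ∃ γ ∈ Γ, s γ x ≠ 1 := fun x hx =>
    Finset.exists_ne_one_of_prod_ne_one hx
  have hθone : ∀ γ ∈ Γ, ∀ x, θ x = 1 → s γ x = 1 := fun γ hγ x hx => by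
    by_contra h
    exact h ((hθeq γ hγ x h).symm.trans hx)
  have hθΛ : ∀ x, x ∉ Λ → θ x = 1 := fun x hx => Finset.prod_eq_one fun γ hγ =>
    (hs γ (hΓ.subset hγ)).eq_one_of_notMem_volume fun h => hx (hΓ.volume_subset γ hγ h)
  -- The flipped spins cancel, so a disagreement after the flip comes from a contour outside `Γ`.
  have hrest : ∀ x, contourFlip Γ σ x = ∏ γ ∈ P \ Γ, s γ x := fun x => by
    rw [hflip x, hP.eq_prod_contourSpin hd hs hσfin x, ← Finset.prod_sdiff hΓ.subset, hθdef,
      mul_assoc, Int.units_mul_self, mul_one]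
  set E : Finset (Site d) → ℝ≥0∞ := fun γ => pairEnergy J α (fun x y =>
    (s γ x ≠ 1 ∧ s γ y = 1) ∧ ∃ γ' ∈ P, γ' ≠ γ ∧ s γ' x ≠ s γ' y) with hE
  set F : Finset (Site d) → ℝ≥0∞ := fun γ => pairEnergy J α fun x y => s γ x ≠ 1 ∧ s γ y = 1
    with hF
  have hFfin : ∀ γ ∈ Γ, F γ ≠ ∞ := fun γ hγ =>
    pairEnergy_ne_top hα hJ (hs γ (hΓ.subset hγ)).finite fun x y h => h.1
  have hEfin : ∀ γ ∈ Γ, E γ ≠ ∞ := fun γ hγ =>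
    pairEnergy_ne_top hα hJ (hs γ (hΓ.subset hγ)).finite fun x y h => h.1.1
  have hθfin : {x | θ x ≠ 1}.Finite := Λ.finite_toSet.subset fun x hx => by
    by_contra h
    exact hx (hθΛ x h)
  -- A pair counted in `F γ` but not cut by `θ` has its second end in the negative region of another
  -- member of `Γ`, so it is counted in `E γ`.
  have hFE : ∑ γ ∈ Γ, F γ ≤ (pairEnergy J α fun x y => θ x ≠ 1 ∧ θ y = 1) + ∑ γ ∈ Γ, E γ := by
    calc ∑ γ ∈ Γ, F γ
        ≤ ∑ γ ∈ Γ, (pairEnergy J α (fun x y => s γ x ≠ 1 ∧ θ y = 1) + E γ) := by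
          refine Finset.sum_le_sum fun γ hγ => (pairEnergy_mono fun x y hxy => ?_).trans
            (pairEnergy_or_le _ _)
          by_cases hy : θ y = 1
          · exact Or.inl ⟨hxy.1, hy⟩
          · obtain ⟨γ', hγ', hy'⟩ := hθex y hy
            have hne : γ' ≠ γ := fun e => hy' (e ▸ hxy.2)
            refine Or.inr ⟨hxy, γ', hΓ.subset hγ', hne, fun e => hy' ?_⟩
            rw [← e]
            exact hΓ.contourSpin_eq_one_of_ne_one hP hs hd hγ hγ' hne hxy.1
      _ ≤ _ := by
          rw [Finset.sum_add_distrib]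
          refine add_le_add_left (sum_pairEnergy_le Γ ?_ ?_) _
          · exact fun γ hγ x y h => ⟨by rw [hθeq γ hγ x h.1]; exact h.1, h.2⟩
          · intro γ hγ γ' hγ' x y h h'
            by_contra hne
            exact h'.1 (hΓ.contourSpin_eq_one_of_ne_one hP hs hd hγ hγ' (Ne.symm hne) h.1)
  have hτE : pairEnergy J α (fun x y => (θ x ≠ 1 ∧ θ y = 1) ∧
      contourFlip Γ σ x ≠ contourFlip Γ σ y) ≤ ∑ γ ∈ Γ, E γ := by
    refine (pairEnergy_mono fun x y h => ?_).trans (pairEnergy_exists_le Γ _)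
    obtain ⟨⟨hx, hy⟩, hτ⟩ := h
    obtain ⟨γ, hγ, hγx⟩ := hθex x hx
    refine ⟨γ, hγ, ⟨hγx, hθone γ hγ y hy⟩, ?_⟩
    by_contra! hcon
    refine hτ ?_
    rw [hrest, hrest]
    refine Finset.prod_congr rfl fun γ' hγ' => ?_
    rw [Finset.mem_sdiff] at hγ'
    exact hcon γ' hγ'.1 fun e => hγ'.2 (e ▸ hγ)
  have h1 := hamiltonian_mul_sub_le hα hJ hσ hθΛ hflip
  have hsumE : ∑ γ ∈ Γ, E γ ≠ ∞ := ENNReal.sum_ne_top.2 hEfin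
  have hN : (pairEnergy J α fun x y => θ x ≠ 1 ∧ θ y = 1) ≠ ∞ :=
    pairEnergy_ne_top hα hJ hθfin fun x y h => h.1
  have h2 := ENNReal.toReal_mono (by finiteness) hFE
  rw [ENNReal.toReal_add hN hsumE, ENNReal.toReal_sum hFfin, ENNReal.toReal_sum hEfin] at h2
  have h3 := ENNReal.toReal_mono hsumE hτE
  rw [ENNReal.toReal_sum hEfin] at h3
  have h4 : ∑ γ ∈ Γ, (E γ).toReal ≤ 1 / 10 * ∑ γ ∈ Γ, (F γ).toReal := by
    rw [Finset.mul_sum]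
    refine Finset.sum_le_sum fun γ hγ => ?_
    have hFγ := hFfin γ hγ
    have := ENNReal.toReal_mono (by finiteness) (hweak γ (hΓ.subset hγ))
    rwa [ENNReal.toReal_mul, ENNReal.toReal_ofReal (by norm_num)] at this
  -- The bounds add up to `-2 ∑ F + 2 ∑ E + 8 ∑ E`, which is why the interaction threshold is `1 /
  -- 10`.
  linarith

end LongRangeIsing

theorem proposition1 (d : ℕ) (hd : 2 ≤ d) (α J : ℝ) (hα : (d : ℝ) < α) (hJ : 0 < J)
    (a r : ℝ) (ha : ((d : ℝ) + 1) / min (α - d) 1 < a) (hr : 0 < r) :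
    ∃ M₀ c₁ c₂ c₃ : ℝ, 0 < M₀ ∧ 0 < c₁ ∧ 0 < c₂ ∧ 0 < c₃ ∧
      ∀ M : ℝ, M₀ ≤ M →
      ∀ (Λ : Finset (LongRangeIsing.Site d)) (σ : LongRangeIsing.Config d),
      σ ∈ LongRangeIsing.configsWithBC Λ (LongRangeIsing.plus d) →
      ∀ P : Finset (Finset (LongRangeIsing.Site d)),
      LongRangeIsing.IsContourPartition M a r σ P →
      ∀ Γ : Finset (Finset (LongRangeIsing.Site d)),
      LongRangeIsing.IsExternalFamily Λ σ P Γ 1 →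
        LongRangeIsing.hamiltonian J α Λ (LongRangeIsing.plus d) (LongRangeIsing.contourFlip Γ σ)
            - LongRangeIsing.hamiltonian J α Λ (LongRangeIsing.plus d) σ
          ≤ ∑ γ ∈ Γ, (- c₁ * (γ.card : ℝ)
              - c₂ * LongRangeIsing.surfaceEnergy J α (LongRangeIsing.labelledInside σ γ (-1))
              - c₃ * LongRangeIsing.surfaceEnergy J α (γ : Set (LongRangeIsing.Site d))) := by
  open LongRangeIsing in
  have hd0 : 0 < d := by omega
  have hdR : (0 : ℝ) < d := by exact_mod_cast hd0
  have hmin : 0 < min (α - d) 1 := lt_min (by linarith) one_pos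
  -- The two bounds on the minimum are used separately: by `1` for the sum over scales, by `α - d`
  -- for `hβ`.
  have ha1 : (d : ℝ) + 1 < a := by
    rw [div_lt_iff₀ hmin] at ha
    have ha0 : 0 < a := by
      by_contra h
      nlinarith
    nlinarith [min_le_right (α - d) 1]
  have ha0 : 0 < a := by linarith
  have hβ : (d : ℝ) < α - d / a := by
    rw [div_lt_iff₀ hmin] at ha
    have h1 : (d : ℝ) < (α - d) * a := by nlinarith [min_le_left (α - d) 1]
    have h2 : (d : ℝ) / a < α - d := by rwa [div_lt_iff₀ ha0]
    linarith
  set n : ℕ := ⌈(2 : ℝ) ^ r⌉₊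
  have hn : (2 : ℝ) ^ r - 1 ≤ n := by
    have := Nat.le_ceil ((2 : ℝ) ^ r)
    linarith
  set k : ℝ := 2 * n
  have hk : 0 ≤ k := by positivity
  set K : ℝ := n * (4 * n + 3) ^ d
  have hK : 0 ≤ K := by positivity
  obtain ⟨M₁, hM₁⟩ := Filter.eventually_atTop.1
    ((IsSeparatedFamily.tendsto_interactionBound d hd0 K α a ha0).eventually
      (ge_mem_nhds (show (0 : ℝ) < 1 / 10 by norm_num)))
  set W : ℝ := J * latticeSum d α with hW
  have hW0 : 0 ≤ W := mul_nonneg hJ.le (latticeSum_nonneg d α)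
  -- `M₁` makes the interaction weak, `2` separates the contours, `4 * k` controls their reach. The
  -- three constants let each term take a third of `F`, using `J * |γ| ≤ 2 * F` and surface energies
  -- at most `W * |γ|` and `F + W * |γ|`.
  refine ⟨max M₁ (max 2 (4 * k)), J / 6, 1 / (3 * (1 + 2 * W / J)), J / (6 * (W + 1)),
    by positivity, by positivity, by positivity, by positivity, ?_⟩
  intro M hM Λ σ hσ P hP Γ hΓ
  have hMM₁ : M₁ ≤ M := (le_max_left _ _).trans hM
  have hM2 : 2 ≤ M := ((le_max_left _ _).trans (le_max_right _ _)).trans hM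
  have hMk : 4 * k ≤ M := ((le_max_right _ _).trans (le_max_right _ _)).trans hM
  obtain ⟨s, hs⟩ := hP.exists_contourSpins hd hM2 ha0.le
  obtain ⟨D, hD⟩ := hP.exists_isSeparatedFamily hd hn hs
  refine (hΓ.hamiltonian_contourFlip_sub_le hP hd0 hs hα hJ.le hσ fun γ hγ => ?_).trans ?_
  · refine (hD.pairEnergy_interaction_le hd0 hk hMk (by linarith) hK ha1 hJ hβ hγ
      (hP.exists_contourSpin_ne_one hs hγ)).trans ?_
    gcongr
    exact hM₁ M hMM₁
  · rw [← Finset.sum_neg_distrib]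
    refine Finset.sum_le_sum fun γ hγ => ?_
    have hγP := hΓ.subset hγ
    have hσfin : {x | σ x ≠ 1}.Finite := Λ.finite_toSet.subset fun x hx => by
      by_contra h
      exact hx (hσ x h)
    have h1 := hP.card_le_pairEnergy hs hα hJ.le hγP
    have h2 := surfaceEnergy_le_card hα hJ.le γ
    have h3 := surfaceEnergy_sdiff_le hα hJ.le (hs γ hγP).finite γ
      (hP.mem_labelledInside_iff hd0 hs hσfin hγP (hΓ.label γ hγ))
    rw [← hW] at h2 h3
    set F := (pairEnergy J α fun x y => s γ x ≠ 1 ∧ s γ y = 1).toReal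
    have hF0 : 0 ≤ F := ENNReal.toReal_nonneg
    have hc : (γ.card : ℝ) ≤ 2 * F / J := by
      rw [le_div_iff₀ hJ]
      linarith
    have h4 : J / 6 * γ.card ≤ F / 3 := by linarith
    have h5 : 1 / (3 * (1 + 2 * W / J)) * surfaceEnergy J α (labelledInside σ γ (-1)) ≤ F / 3 := by
      have h6 : surfaceEnergy J α (labelledInside σ γ (-1)) ≤ F * (1 + 2 * W / J) := by
        refine h3.trans ?_
        have := mul_le_mul_of_nonneg_left hc hW0
        calc F + W * γ.card ≤ F + W * (2 * F / J) := by linarith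
          _ = F * (1 + 2 * W / J) := by ring
      rw [div_mul_eq_mul_div, div_le_iff₀ (by positivity)]
      linarith
    have h7 : J / (6 * (W + 1)) * surfaceEnergy J α (γ : Set (Site d)) ≤ F / 3 := by
      rw [div_mul_eq_mul_div, div_le_iff₀ (by positivity)]
      have h8 : J * surfaceEnergy J α (γ : Set (Site d)) ≤ J * (W * γ.card) :=
        mul_le_mul_of_nonneg_left h2 hJ.le
      have h9 : W * (J * γ.card) ≤ W * (2 * F) := mul_le_mul_of_nonneg_left h1 hW0
      linarith
    linarith
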